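/- **Setting.** The finite types are generated from $0$ by $\sigma,\tau\mapsto(\sigma\to\tau)$. $\mathsf{E\text{-}HA}^\omega$ is extensional Heyting arithmetic in all finite types: many-sorted intuitionistic logic; terms built from variables, $0$, $S$, the combinators $\Pi_{\sigma,\tau},\Sigma_{\rho,\sigma,\tau}$ and the recursors $R_\sigma$ by application; equality primitive at type $0$ and pointwise at higher types; axioms for $=_0$, for $S$, the defining equations of the constants, full extensionality, and induction for all formulas of its language. Put $x\le^*_0y :\equiv x\le y$ and $x\le^*_{\rho\to\sigma}y:\equiv\forall v\,\forall u\le^*_\rho v\,(xu\le^*_\sigma yv\wedge yu\le^*_\sigma yv)$; $x$ is *monotone* if $x\le^*x$. The language of $\mathsf{E\text{-}HA}^\omega_{\mathrm{st}}$ has in addition a unary predicate $\mathrm{st}^\sigma$ for each type $\sigma$; a formula without $\mathrm{st}$ is *internal*. Lower-case Greek letters $\phi,\psi$ denote internal formulas, upper-case ones arbitrary formulas. $\forall^{\mathrm{st}},\exists^{\mathrm{st}}$ are relativized to standard elements, $\tilde\forall,\tilde\exists$ to monotone elements, $\tilde\forall^{\mathrm{st}},\tilde\exists^{\mathrm{st}}$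 to elements that are both. $\mathsf{E\text{-}HA}^\omega_{\mathrm{st}}$ adds to $\mathsf{E\text{-}HA}^\omega$ (with intuitionistic logic for all formulas) the axioms 1. $x=_\sigma y\to(\mathrm{st}(x)\to\mathrm{st}(y))$; 2. $\mathrm{st}(y)\to(x\le^*y\to\mathrm{st}(x))$; 3. $\mathrm{st}(t)$ for each closed term $t$; 4. $\mathrm{st}(z)\to(\mathrm{st}(x)\to\mathrm{st}(zx))$; and the external induction rule: from $\Phi(0)$ and $\forall^{\mathrm{st}}n^0(\Phi(n)\to\Phi(n+1))$ infer $\forall^{\mathrm{st}}n^0\,\Phi(n)$. **Principles.** Below, variables stand for finite tuples of variables (a single variable in $\mathsf{MAJ}^\omega$), and variables quantified anew on a right-hand side do not occur elsewhere. - $\mathsf{mAC}^\omega$: $\tilde\forall^{\mathrm{st}}x\,\tilde\exists^{\mathrm{st}}y\,\Phi(x,y)\to\tilde\exists^{\mathrm{st}}f\,\tilde\forall^{\mathrm{st}}x\,\tilde\exists y\le^*fx\;\Phi(x,y)$. - $\mathsf{R}^\omega$: $\forall x\,\exists^{\mathrm{st}}y\,\Phi(x,y)\to\tilde\exists^{\mathrm{st}}z\,\forall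 x\,\exists y\le^*z\;\Phi(x,y)$. - $\mathsf{I}^\omega$: $\tilde\forall^{\mathrm{st}}z\,\exists x\,\forall y\le^*z\;\phi(x,y)\to\exists x\,\forall^{\mathrm{st}}y\,\phi(x,y)$. - $\mathsf{IP}^\omega_{\tilde\forall^{\mathrm{st}}}$: $(\Phi\to\tilde\exists^{\mathrm{st}}y\,\Psi(y))\to\tilde\exists^{\mathrm{st}}y\,(\Phi\to\tilde\exists z\le^*y\;\Psi(z))$, where $\Phi$ is of the form $\tilde\forall^{\mathrm{st}}x\,\phi(x)$ with $y$ not free in $\Phi$. - $\mathsf{MP}^{\mathrm{st}}$: $(\tilde\forall^{\mathrm{st}}x\,\phi(x)\to\psi)\to\tilde\exists^{\mathrm{st}}y\,(\tilde\forall x\le^*y\;\phi(x)\to\psi)$. - $\mathsf{MAJ}^\omega$: $\forall^{\mathrm{st}}x\,\exists^{\mathrm{st}}y\,(x\le^*y)$. **Interpretation.** To each formula $\Phi$ is assigned $\Phi^{\mathrm{I_{st}}}\equiv\tilde\exists^{\mathrm{st}}b\,\tilde\forall^{\mathrm{st}}c\,\Phi_{\mathrm{I_{st}}}(b,c)$,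 with $b,c$ (possibly empty) tuples and $\Phi_{\mathrm{I_{st}}}$ internal: $\Phi^{\mathrm{I_{st}}}$ and $\Phi_{\mathrm{I_{st}}}$ are $\Phi$ for internal $\Phi$; $\mathrm{st}(t)^{\mathrm{I_{st}}}$ is $\tilde\exists^{\mathrm{st}}c\,[t\le^*c]$; and if $\Phi^{\mathrm{I_{st}}}\equiv\tilde\exists^{\mathrm{st}}b\,\tilde\forall^{\mathrm{st}}c\,\Phi_{\mathrm{I_{st}}}(b,c)$, $\Psi^{\mathrm{I_{st}}}\equiv\tilde\exists^{\mathrm{st}}d\,\tilde\forall^{\mathrm{st}}e\,\Psi_{\mathrm{I_{st}}}(d,e)$, then - $(\Phi\wedge\Psi)^{\mathrm{I_{st}}}$ is $\tilde\exists^{\mathrm{st}}b,d\,\tilde\forall^{\mathrm{st}}c,e\,[\Phi_{\mathrm{I_{st}}}(b,c)\wedge\Psi_{\mathrm{I_{st}}}(d,e)]$; - $(\Phi\vee\Psi)^{\mathrm{I_{st}}}$ is $\tilde\exists^{\mathrm{st}}b,d\,\tilde\forall^{\mathrm{st}}c,e\,[\tilde\forall c'\le^*c\;\Phi_{\mathrm{I_{st}}}(b,c')\vee\tilde\forall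 e'\le^*e\;\Psi_{\mathrm{I_{st}}}(d,e')]$; - $(\Phi\to\Psi)^{\mathrm{I_{st}}}$ is $\tilde\exists^{\mathrm{st}}f,g\,\tilde\forall^{\mathrm{st}}b,e\,[\tilde\forall c\le^*gbe\;\Phi_{\mathrm{I_{st}}}(b,c)\to\Psi_{\mathrm{I_{st}}}(fb,e)]$; - $(\forall x\,\Phi(x))^{\mathrm{I_{st}}}$ is $\tilde\exists^{\mathrm{st}}b\,\tilde\forall^{\mathrm{st}}c\,[\forall x\,\Phi_{\mathrm{I_{st}}}(x,b,c)]$; - $(\exists x\,\Phi(x))^{\mathrm{I_{st}}}$ is $\tilde\exists^{\mathrm{st}}b\,\tilde\forall^{\mathrm{st}}c\,[\exists x\,\tilde\forall c'\le^*c\;\Phi_{\mathrm{I_{st}}}(x,b,c')]$. **Theorem (Characterization).** Let $\Phi$ be an arbitrary formula, possibly with free variables. Then $$\mathsf{E\text{-}HA}^\omega_{\mathrm{st}}+\mathsf{mAC}^\omega+\mathsf{R}^\omega+\mathsf{I}^\omega+\mathsf{MP}^{\mathrm{st}}+\mathsf{IP}^\omega_{\tilde\forall^{\mathrm{st}}}+\mathsf{MAJ}^\omega\vdash\Phi^{\mathrm{I_{st}}}\leftrightarrow\Phi.$$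 -/

import Mathlib

namespace NonstandardHA

/-! Finite types, typed terms and formulas (well-scoped, with de Bruijn variables). -/

/-- The finite types: the ground type `0` of natural numbers and function types. -/
inductive Ty : Type
  | nat : Ty
  | arr : Ty → Ty → Ty

/-- A context: the types of the variables that may occur free. -/
abbrev Ctx : Type := List Ty

/-- Variables of type `σ` in a context. -/
inductive Var : Ctx → Ty → Type
  | vz {Γ : Ctx} {σ : Ty} : Var (σ :: Γ) σ
  | vs {Γ : Ctx} {σ τ : Ty} : Var Γ σ → Var (τ :: Γ) σ

/-- Terms of Heyting arithmetic in all finite types: variables, zero, successor, the combinators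
`K` (also written `Π`) and `S` (also written `Σ`), the recursors, and application. -/
inductive Tm (Γ : Ctx) : Ty → Type
  | var {σ : Ty} : Var Γ σ → Tm Γ σ
  | zero : Tm Γ Ty.nat
  | succ : Tm Γ (Ty.arr Ty.nat Ty.nat)
  | K (σ τ : Ty) : Tm Γ (Ty.arr σ (Ty.arr τ σ))
  | S (ρ σ τ : Ty) :
      Tm Γ (Ty.arr (Ty.arr ρ (Ty.arr σ τ)) (Ty.arr (Ty.arr ρ σ) (Ty.arr ρ τ)))
  | R (σ : Ty) :
      Tm Γ (Ty.arr Ty.nat (Ty.arr σ (Ty.arr (Ty.arr σ (Ty.arr Ty.nat σ)) σ)))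
  | app {σ τ : Ty} : Tm Γ (Ty.arr σ τ) → Tm Γ σ → Tm Γ τ

/-- Formulas of the language with the standardness predicates. Equality is primitive at type `0`
only. -/
inductive Fm : Ctx → Type
  | eq0 {Γ : Ctx} : Tm Γ Ty.nat → Tm Γ Ty.nat → Fm Γ
  | st {Γ : Ctx} {σ : Ty} : Tm Γ σ → Fm Γ
  | bot {Γ : Ctx} : Fm Γ
  | and {Γ : Ctx} : Fm Γ → Fm Γ → Fm Γ
  | or {Γ : Ctx} : Fm Γ → Fm Γ → Fm Γ
  | imp {Γ : Ctx} : Fm Γ → Fm Γ → Fm Γ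
  | all {Γ : Ctx} (σ : Ty) : Fm (σ :: Γ) → Fm Γ
  | ex {Γ : Ctx} (σ : Ty) : Fm (σ :: Γ) → Fm Γ

def Fm.iff {Γ : Ctx} (A B : Fm Γ) : Fm Γ := (A.imp B).and (B.imp A)

/-- A formula is internal if no standardness predicate occurs in it. -/
def Fm.Internal : {Γ : Ctx} → Fm Γ → Prop
  | _, .eq0 _ _ => True
  | _, .st _ => False
  | _, .bot => True
  | _, .and A B => A.Internal ∧ B.Internal
  | _, .or A B => A.Internal ∧ B.Internal
  | _, .imp A B => A.Internal ∧ B.Internal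
  | _, .all _ A => A.Internal
  | _, .ex _ A => A.Internal

/-! Renaming and substitution. -/

def Ren (Γ Δ : Ctx) : Type := ∀ σ : Ty, Var Γ σ → Var Δ σ

def Ren.lift {Γ Δ : Ctx} (r : Ren Γ Δ) (τ : Ty) : Ren (τ :: Γ) (τ :: Δ)
  | _, .vz => .vz
  | _, .vs x => .vs (r _ x)

/-- Weakening by one variable. -/
def Ren.wk {Γ : Ctx} (τ : Ty) : Ren Γ (τ :: Γ) := fun _ x => .vs x

/-- The embedding of the empty context into any context. -/
def Ren.empty (Γ : Ctx) : Ren [] Γ := fun _ x => nomatch x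

def Tm.rename {Γ Δ : Ctx} (r : Ren Γ Δ) : {σ : Ty} → Tm Γ σ → Tm Δ σ
  | _, .var x => .var (r _ x)
  | _, .zero => .zero
  | _, .succ => .succ
  | _, .K σ τ => .K σ τ
  | _, .S ρ σ τ => .S ρ σ τ
  | _, .R σ => .R σ
  | _, .app s t => .app (s.rename r) (t.rename r)

def Fm.rename : {Γ Δ : Ctx} → Ren Γ Δ → Fm Γ → Fm Δ
  | _, _, r, .eq0 s t => .eq0 (s.rename r) (t.rename r)
  | _, _, r, .st t => .st (t.rename r)
  | _, _, _, .bot => .bot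
  | _, _, r, .and A B => .and (A.rename r) (B.rename r)
  | _, _, r, .or A B => .or (A.rename r) (B.rename r)
  | _, _, r, .imp A B => .imp (A.rename r) (B.rename r)
  | _, _, r, .all σ A => .all σ (A.rename (r.lift σ))
  | _, _, r, .ex σ A => .ex σ (A.rename (r.lift σ))

def Sub (Γ Δ : Ctx) : Type := ∀ σ : Ty, Var Γ σ → Tm Δ σ

def Sub.id (Γ : Ctx) : Sub Γ Γ := fun _ x => .var x

def Sub.rename {Γ Δ Θ : Ctx} (s : Sub Γ Δ) (r : Ren Δ Θ) : Sub Γ Θ := fun _ x => (s _ x).rename r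

/-- Extend a substitution by a term for the most recent variable. -/
def Sub.cons {Γ Δ : Ctx} {τ : Ty} (t : Tm Δ τ) (s : Sub Γ Δ) : Sub (τ :: Γ) Δ
  | _, .vz => t
  | _, .vs x => s _ x

def Sub.lift {Γ Δ : Ctx} (s : Sub Γ Δ) (τ : Ty) : Sub (τ :: Γ) (τ :: Δ) :=
  Sub.cons (.var .vz) (s.rename (Ren.wk τ))

def Tm.subst {Γ Δ : Ctx} (s : Sub Γ Δ) : {σ : Ty} → Tm Γ σ → Tm Δ σ
  | _, .var x => s _ x
  | _, .zero => .zero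
  | _, .succ => .succ
  | _, .K σ τ => .K σ τ
  | _, .S ρ σ τ => .S ρ σ τ
  | _, .R σ => .R σ
  | _, .app t u => .app (t.subst s) (u.subst s)

def Fm.subst : {Γ Δ : Ctx} → Sub Γ Δ → Fm Γ → Fm Δ
  | _, _, s, .eq0 t u => .eq0 (t.subst s) (u.subst s)
  | _, _, s, .st t => .st (t.subst s)
  | _, _, _, .bot => .bot
  | _, _, s, .and A B => .and (A.subst s) (B.subst s)
  | _, _, s, .or A B => .or (A.subst s) (B.subst s)
  | _, _, s, .imp A B => .imp (A.subst s) (B.subst s)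
  | _, _, s, .all σ A => .all σ (A.subst (s.lift σ))
  | _, _, s, .ex σ A => .ex σ (A.subst (s.lift σ))

/-- `A(t)`, for `A(x)` with `x` the most recent variable. -/
def Fm.inst {Γ : Ctx} {σ : Ty} (A : Fm (σ :: Γ)) (t : Tm Γ σ) : Fm Γ :=
  A.subst (Sub.cons t (Sub.id Γ))

/-- `A(x + 1)`, for `A(x)` with `x` the most recent variable. -/
def Fm.step {Γ : Ctx} (A : Fm (Ty.nat :: Γ)) : Fm (Ty.nat :: Γ) :=
  A.subst (Sub.cons (.app .succ (.var .vz)) ((Sub.id Γ).rename (Ren.wk Ty.nat)))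

/-- Weakening of terms and formulas by one fresh variable. -/
def Tm.wk {Γ : Ctx} {σ : Ty} (τ : Ty) (t : Tm Γ σ) : Tm (τ :: Γ) σ := t.rename (Ren.wk τ)

def Fm.wk {Γ : Ctx} (τ : Ty) (A : Fm Γ) : Fm (τ :: Γ) := A.rename (Ren.wk τ)

/-! Equality, order and strong majorizability. -/

/-- Equality at all types, defined pointwise at function types. -/
def eq : {Γ : Ctx} → (σ : Ty) → Tm Γ σ → Tm Γ σ → Fm Γ
  | _, .nat, s, t => .eq0 s t
  | _, .arr σ τ, s, t => .all σ (eq τ (.app (s.wk σ) (.var .vz)) (.app (t.wk σ) (.var .vz)))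

/-- Addition, by recursion on the second argument; the step term `S (K K) succ` is
`fun m n => m + 1`. -/
def Tm.add {Γ : Ctx} (s t : Tm Γ Ty.nat) : Tm Γ Ty.nat :=
  .app (.app (.app (.R Ty.nat) t) s)
    (.app (.app (.S Ty.nat Ty.nat (Ty.arr Ty.nat Ty.nat))
      (.app (.K (Ty.arr Ty.nat (Ty.arr Ty.nat Ty.nat)) Ty.nat) (.K Ty.nat Ty.nat))) .succ)

/-- `s ≤ t` at type `0`, that is, `∃ z, s + z = t`. -/
def le0 {Γ : Ctx} (s t : Tm Γ Ty.nat) : Fm Γ :=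
  .ex Ty.nat (.eq0 ((s.wk Ty.nat).add (.var .vz)) (t.wk Ty.nat))

/-- Strong majorizability `s ≤* t`; at a function type it is
`∀ v, ∀ u ≤* v, (s u ≤* t v ∧ t u ≤* t v)`. -/
def maj : {Γ : Ctx} → (σ : Ty) → Tm Γ σ → Tm Γ σ → Fm Γ
  | _, .nat, s, t => le0 s t
  | _, .arr σ τ, s, t =>
      .all σ (.all σ (.imp (maj σ (.var .vz) (.var (.vs .vz)))
        (.and
          (maj τ (.app ((s.wk σ).wk σ) (.var .vz)) (.app ((t.wk σ).wk σ) (.var (.vs .vz))))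
          (maj τ (.app ((t.wk σ).wk σ) (.var .vz)) (.app ((t.wk σ).wk σ) (.var (.vs .vz)))))))

/-- `t` is monotone. -/
def mon {Γ : Ctx} {σ : Ty} (t : Tm Γ σ) : Fm Γ := maj σ t t

/-! Tuples of terms and blocks of quantifiers. -/

/-- Tuples of terms with a given list of types. -/
def Tms (Γ : Ctx) : List Ty → Type
  | [] => Unit
  | σ :: σs => Tm Γ σ × Tms Γ σs

def Tms.rename {Γ Δ : Ctx} (r : Ren Γ Δ) : {σs : List Ty} → Tms Γ σs → Tms Δ σs
  | [], _ => ()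
  | _ :: _, t => (t.1.rename r, Tms.rename r t.2)

/-- The two parts of a concatenated tuple. -/
def Tms.left {Γ : Ctx} : (σs : List Ty) → {τs : List Ty} → Tms Γ (σs ++ τs) → Tms Γ σs
  | [], _, _ => ()
  | _ :: σs, _, t => (t.1, Tms.left σs t.2)

def Tms.right {Γ : Ctx} : (σs : List Ty) → {τs : List Ty} → Tms Γ (σs ++ τs) → Tms Γ τs
  | [], _, t => t
  | _ :: σs, _, t => Tms.right σs t.2

/-- The type of functions of a tuple of arguments, in curried form. -/
def arrs : List Ty → Ty → Ty
  | [], τ => τ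
  | σ :: σs, τ => .arr σ (arrs σs τ)

/-- Application of a term to a tuple of arguments. -/
def Tm.apps {Γ : Ctx} : (σs : List Ty) → {τ : Ty} → Tm Γ (arrs σs τ) → Tms Γ σs → Tm Γ τ
  | [], _, f, _ => f
  | _ :: σs, _, f, t => Tm.apps σs (.app f t.1) t.2

/-- Application of each member of a tuple of functions to the same tuple of arguments. -/
def Tms.apps {Γ : Ctx} (σs : List Ty) :
    (τs : List Ty) → Tms Γ (τs.map (arrs σs)) → Tms Γ σs → Tms Γ τs
  | [], _, _ => ()
  | _ :: τs, f, t => (Tm.apps σs f.1 t, Tms.apps σs τs f.2 t)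

/-- Extension of a context by a tuple of variables (the last one becomes the most recent). -/
def ext : Ctx → List Ty → Ctx
  | Γ, [] => Γ
  | Γ, σ :: σs => ext (σ :: Γ) σs

/-- Weakening by a tuple of variables. -/
def Ren.wks : {Γ : Ctx} → (σs : List Ty) → Ren Γ (ext Γ σs)
  | _, [] => fun _ x => x
  | _, _ :: σs => fun τ x => Ren.wks σs τ (.vs x)

def Ren.lifts : {Γ Δ : Ctx} → Ren Γ Δ → (σs : List Ty) → Ren (ext Γ σs) (ext Δ σs)
  | _, _, r, [] => r
  | _, _, r, σ :: σs => Ren.lifts (r.lift σ) σs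

/-- The tuple of the freshly added variables. -/
def vars : {Γ : Ctx} → (σs : List Ty) → Tms (ext Γ σs) σs
  | _, [] => ()
  | _, _ :: σs => (.var (Ren.wks σs _ .vz), vars σs)

def Tms.wks {Γ : Ctx} (σs : List Ty) {τs : List Ty} (t : Tms Γ τs) : Tms (ext Γ σs) τs :=
  t.rename (Ren.wks σs)

def Fm.wks {Γ : Ctx} (σs : List Ty) (A : Fm Γ) : Fm (ext Γ σs) := A.rename (Ren.wks σs)

def Sub.wks {Γ Δ : Ctx} (σs : List Ty) (s : Sub Γ Δ) : Sub Γ (ext Δ σs) := s.rename (Ren.wks σs)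

/-- `∀ x` for a tuple `x`. -/
def allT : {Γ : Ctx} → (σs : List Ty) → Fm (ext Γ σs) → Fm Γ
  | _, [], A => A
  | _, σ :: σs, A => .all σ (allT σs A)

/-- `∃ x` for a tuple `x`. -/
def exT : {Γ : Ctx} → (σs : List Ty) → Fm (ext Γ σs) → Fm Γ
  | _, [], A => A
  | _, σ :: σs, A => .ex σ (exT σs A)

/-- `∀ˢᵗ x` for a tuple `x`. -/
def allSt : {Γ : Ctx} → (σs : List Ty) → Fm (ext Γ σs) → Fm Γ
  | _, [], A => A
  | _, σ :: σs, A => .all σ (.imp (.st (.var .vz)) (allSt σs A))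

/-- `∃ˢᵗ x` for a tuple `x`. -/
def exSt : {Γ : Ctx} → (σs : List Ty) → Fm (ext Γ σs) → Fm Γ
  | _, [], A => A
  | _, σ :: σs, A => .ex σ (.and (.st (.var .vz)) (exSt σs A))

/-- `∀̃ˢᵗ x` (over standard monotone elements) for a tuple `x`. -/
def allStMon : {Γ : Ctx} → (σs : List Ty) → Fm (ext Γ σs) → Fm Γ
  | _, [], A => A
  | _, σ :: σs, A =>
      .all σ (.imp (.and (.st (.var .vz)) (mon (.var .vz))) (allStMon σs A))

/-- `∃̃ˢᵗ x` (over standard monotone elements) for a tuple `x`. -/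
def exStMon : {Γ : Ctx} → (σs : List Ty) → Fm (ext Γ σs) → Fm Γ
  | _, [], A => A
  | _, σ :: σs, A =>
      .ex σ (.and (.and (.st (.var .vz)) (mon (.var .vz))) (exStMon σs A))

/-- `∀ x ≤* t` for tuples `x`, `t`. -/
def allLe : {Γ : Ctx} → (σs : List Ty) → Tms Γ σs → Fm (ext Γ σs) → Fm Γ
  | _, [], _, A => A
  | _, σ :: σs, t, A =>
      .all σ (.imp (maj σ (.var .vz) (t.1.wk σ)) (allLe σs (t.2.rename (Ren.wk σ)) A))

/-- `∃ x ≤* t` for tuples `x`, `t`. -/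
def exLe : {Γ : Ctx} → (σs : List Ty) → Tms Γ σs → Fm (ext Γ σs) → Fm Γ
  | _, [], _, A => A
  | _, σ :: σs, t, A =>
      .ex σ (.and (maj σ (.var .vz) (t.1.wk σ)) (exLe σs (t.2.rename (Ren.wk σ)) A))

/-- `∀̃ x ≤* t` (over monotone elements) for tuples `x`, `t`. -/
def allLeMon : {Γ : Ctx} → (σs : List Ty) → Tms Γ σs → Fm (ext Γ σs) → Fm Γ
  | _, [], _, A => A
  | _, σ :: σs, t, A =>
      .all σ (.imp (.and (mon (.var .vz)) (maj σ (.var .vz) (t.1.wk σ)))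
        (allLeMon σs (t.2.rename (Ren.wk σ)) A))

/-- `∃̃ x ≤* t` (over monotone elements) for tuples `x`, `t`. -/
def exLeMon : {Γ : Ctx} → (σs : List Ty) → Tms Γ σs → Fm (ext Γ σs) → Fm Γ
  | _, [], _, A => A
  | _, σ :: σs, t, A =>
      .ex σ (.and (.and (mon (.var .vz)) (maj σ (.var .vz) (t.1.wk σ)))
        (exLeMon σs (t.2.rename (Ren.wk σ)) A))

/-! Axioms of the base theory. Axioms with parameters are given for arbitrary terms. -/

/-- The non-logical axioms of extensional Heyting arithmetic in all finite types. -/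
inductive EHA : {Γ : Ctx} → Fm Γ → Prop
  | eq_refl {Γ : Ctx} (s : Tm Γ Ty.nat) : EHA (.eq0 s s)
  | eq_symm {Γ : Ctx} (s t : Tm Γ Ty.nat) : EHA (.imp (.eq0 s t) (.eq0 t s))
  | eq_trans {Γ : Ctx} (s t u : Tm Γ Ty.nat) :
      EHA (.imp (.eq0 s t) (.imp (.eq0 t u) (.eq0 s u)))
  | extensionality {Γ : Ctx} {σ τ : Ty} (f : Tm Γ (Ty.arr σ τ)) (s t : Tm Γ σ) :
      EHA (.imp (eq σ s t) (eq τ (.app f s) (.app f t)))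
  | succ_ne_zero {Γ : Ctx} (s : Tm Γ Ty.nat) : EHA (.imp (.eq0 (.app .succ s) .zero) .bot)
  | succ_inj {Γ : Ctx} (s t : Tm Γ Ty.nat) :
      EHA (.imp (.eq0 (.app .succ s) (.app .succ t)) (.eq0 s t))
  | K_eq {Γ : Ctx} {σ τ : Ty} (s : Tm Γ σ) (t : Tm Γ τ) :
      EHA (eq σ (.app (.app (.K σ τ) s) t) s)
  | S_eq {Γ : Ctx} {ρ σ τ : Ty} (s : Tm Γ (Ty.arr ρ (Ty.arr σ τ))) (t : Tm Γ (Ty.arr ρ σ))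
      (u : Tm Γ ρ) :
      EHA (eq τ (.app (.app (.app (.S ρ σ τ) s) t) u) (.app (.app s u) (.app t u)))
  | R_zero {Γ : Ctx} {σ : Ty} (s : Tm Γ σ) (t : Tm Γ (Ty.arr σ (Ty.arr Ty.nat σ))) :
      EHA (eq σ (.app (.app (.app (.R σ) .zero) s) t) s)
  | R_succ {Γ : Ctx} {σ : Ty} (n : Tm Γ Ty.nat) (s : Tm Γ σ)
      (t : Tm Γ (Ty.arr σ (Ty.arr Ty.nat σ))) :
      EHA (eq σ (.app (.app (.app (.R σ) (.app .succ n)) s) t)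
        (.app (.app t (.app (.app (.app (.R σ) n) s) t)) n))
  | induction {Γ : Ctx} (A : Fm (Ty.nat :: Γ)) (hA : A.Internal) :
      EHA (.imp (A.inst .zero) (.imp (.all Ty.nat (.imp A A.step)) (.all Ty.nat A)))

/-- The standardness axioms. -/
inductive StAx : {Γ : Ctx} → Fm Γ → Prop
  | eq {Γ : Ctx} {σ : Ty} (s t : Tm Γ σ) : StAx (.imp (eq σ s t) (.imp (.st s) (.st t)))
  | maj {Γ : Ctx} {σ : Ty} (s t : Tm Γ σ) : StAx (.imp (.st t) (.imp (maj σ s t) (.st s)))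
  | closed {Γ : Ctx} {σ : Ty} (t : Tm [] σ) : StAx (Γ := Γ) (.st (t.rename (Ren.empty Γ)))
  | app {Γ : Ctx} {σ τ : Ty} (f : Tm Γ (Ty.arr σ τ)) (t : Tm Γ σ) :
      StAx (.imp (.st f) (.imp (.st t) (.st (.app f t))))

/-! The characteristic principles, for tuples of variables. A renaming of the form
`Ren.lifts … (Ren.wks …)` only moves a formula past freshly quantified variables that do not
occur in it. -/

/-- Monotone choice:
`∀̃ˢᵗ x ∃̃ˢᵗ y A(x,y) → ∃̃ˢᵗ f ∀̃ˢᵗ x ∃̃ y ≤* f x, A(x,y)`. -/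
def mAC {Γ : Ctx} (σs τs : List Ty) (A : Fm (ext (ext Γ σs) τs)) : Fm Γ :=
  .imp (allStMon σs (exStMon τs A))
    (exStMon (τs.map (arrs σs)) (allStMon σs
      (exLeMon τs (Tms.apps σs τs ((vars (τs.map (arrs σs))).wks σs) (vars σs))
        (A.rename (((Ren.wks (τs.map (arrs σs))).lifts σs).lifts τs)))))

/-- Realization: `∀ x ∃ˢᵗ y A(x,y) → ∃̃ˢᵗ z ∀ x ∃ y ≤* z, A(x,y)`. -/
def Realization {Γ : Ctx} (σs τs : List Ty) (A : Fm (ext (ext Γ σs) τs)) : Fm Γ :=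
  .imp (allT σs (exSt τs A))
    (exStMon τs (allT σs (exLe τs ((vars τs).wks σs)
      (A.rename (((Ren.wks τs).lifts σs).lifts τs)))))

/-- Idealization: `∀̃ˢᵗ z ∃ x ∀ y ≤* z, A(x,y) → ∃ x ∀ˢᵗ y A(x,y)`. -/
def Idealization {Γ : Ctx} (σs τs : List Ty) (A : Fm (ext (ext Γ σs) τs)) : Fm Γ :=
  .imp
    (allStMon τs (exT σs (allLe τs ((vars τs).wks σs)
      (A.rename (((Ren.wks τs).lifts σs).lifts τs)))))
    (exT σs (allSt τs A))

/-- Independence of premises: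
`(∀̃ˢᵗ x A(x) → ∃̃ˢᵗ y B(y)) → ∃̃ˢᵗ y (∀̃ˢᵗ x A(x) → ∃̃ z ≤* y, B(z))`. -/
def IP {Γ : Ctx} (σs τs : List Ty) (A : Fm (ext Γ σs)) (B : Fm (ext Γ τs)) : Fm Γ :=
  .imp (.imp (allStMon σs A) (exStMon τs B))
    (exStMon τs (.imp ((allStMon σs A).wks τs)
      (exLeMon τs (vars τs) (B.rename ((Ren.wks τs).lifts τs)))))

/-- Markov's principle:
`(∀̃ˢᵗ x A(x) → B) → ∃̃ˢᵗ y (∀̃ x ≤* y, A(x) → B)`. -/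
def MP {Γ : Ctx} (σs : List Ty) (A : Fm (ext Γ σs)) (B : Fm Γ) : Fm Γ :=
  .imp (.imp (allStMon σs A) B)
    (exStMon σs (.imp (allLeMon σs (vars σs) (A.rename ((Ren.wks σs).lifts σs))) (B.wks σs)))

/-- Majorizability axiom: `∀ˢᵗ x ∃ˢᵗ y, x ≤* y`. -/
def MAJ {Γ : Ctx} (σ : Ty) : Fm Γ :=
  .all σ (.imp (.st (.var .vz))
    (.ex σ (.and (.st (.var .vz)) (maj σ (.var (.vs .vz)) (.var .vz)))))

/-- The instances of the six characteristic principles. -/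
inductive CharAx : {Γ : Ctx} → Fm Γ → Prop
  | mAC {Γ : Ctx} (σs τs : List Ty) (A : Fm (ext (ext Γ σs) τs)) : CharAx (mAC σs τs A)
  | R {Γ : Ctx} (σs τs : List Ty) (A : Fm (ext (ext Γ σs) τs)) : CharAx (Realization σs τs A)
  | I {Γ : Ctx} (σs τs : List Ty) (A : Fm (ext (ext Γ σs) τs)) (hA : A.Internal) :
      CharAx (Idealization σs τs A)
  | IP {Γ : Ctx} (σs τs : List Ty) (A : Fm (ext Γ σs)) (hA : A.Internal) (B : Fm (ext Γ τs)) :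
      CharAx (IP σs τs A B)
  | MP {Γ : Ctx} (σs : List Ty) (A : Fm (ext Γ σs)) (hA : A.Internal) (B : Fm Γ)
      (hB : B.Internal) : CharAx (MP σs A B)
  | MAJ {Γ : Ctx} (σ : Ty) : CharAx (Γ := Γ) (MAJ σ)

/-! Derivability. -/

/-- Derivability from the assumptions `H` in many-sorted intuitionistic predicate logic (natural
deduction), with the non-logical axioms of extensional Heyting arithmetic, the standardness
axioms, the external induction rule, and the additional axioms `Ax`. -/
inductive Derives (Ax : ∀ Γ : Ctx, Fm Γ → Prop) : {Γ : Ctx} → List (Fm Γ) → Fm Γ → Prop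
  | hyp {Γ : Ctx} {H : List (Fm Γ)} {A : Fm Γ} : A ∈ H → Derives Ax H A
  | botE {Γ : Ctx} {H : List (Fm Γ)} {A : Fm Γ} : Derives Ax H .bot → Derives Ax H A
  | andI {Γ : Ctx} {H : List (Fm Γ)} {A B : Fm Γ} :
      Derives Ax H A → Derives Ax H B → Derives Ax H (.and A B)
  | andE₁ {Γ : Ctx} {H : List (Fm Γ)} {A B : Fm Γ} : Derives Ax H (.and A B) → Derives Ax H A
  | andE₂ {Γ : Ctx} {H : List (Fm Γ)} {A B : Fm Γ} : Derives Ax H (.and A B) → Derives Ax H B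
  | orI₁ {Γ : Ctx} {H : List (Fm Γ)} {A B : Fm Γ} : Derives Ax H A → Derives Ax H (.or A B)
  | orI₂ {Γ : Ctx} {H : List (Fm Γ)} {A B : Fm Γ} : Derives Ax H B → Derives Ax H (.or A B)
  | orE {Γ : Ctx} {H : List (Fm Γ)} {A B C : Fm Γ} :
      Derives Ax H (.or A B) → Derives Ax (A :: H) C → Derives Ax (B :: H) C → Derives Ax H C
  | impI {Γ : Ctx} {H : List (Fm Γ)} {A B : Fm Γ} :
      Derives Ax (A :: H) B → Derives Ax H (.imp A B)
  | impE {Γ : Ctx} {H : List (Fm Γ)} {A B : Fm Γ} :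
      Derives Ax H (.imp A B) → Derives Ax H A → Derives Ax H B
  | allI {Γ : Ctx} {H : List (Fm Γ)} {σ : Ty} {A : Fm (σ :: Γ)} :
      Derives Ax (H.map (Fm.wk σ)) A → Derives Ax H (.all σ A)
  | allE {Γ : Ctx} {H : List (Fm Γ)} {σ : Ty} {A : Fm (σ :: Γ)} (t : Tm Γ σ) :
      Derives Ax H (.all σ A) → Derives Ax H (A.inst t)
  | exI {Γ : Ctx} {H : List (Fm Γ)} {σ : Ty} {A : Fm (σ :: Γ)} (t : Tm Γ σ) :
      Derives Ax H (A.inst t) → Derives Ax H (.ex σ A)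
  | exE {Γ : Ctx} {H : List (Fm Γ)} {σ : Ty} {A : Fm (σ :: Γ)} {C : Fm Γ} :
      Derives Ax H (.ex σ A) → Derives Ax (A :: H.map (Fm.wk σ)) (C.wk σ) → Derives Ax H C
  | eha {Γ : Ctx} {H : List (Fm Γ)} {A : Fm Γ} : EHA A → Derives Ax H A
  | stAx {Γ : Ctx} {H : List (Fm Γ)} {A : Fm Γ} : StAx A → Derives Ax H A
  | extInd {Γ : Ctx} {H : List (Fm Γ)} {A : Fm (Ty.nat :: Γ)} :
      Derives Ax H (A.inst .zero) →
      Derives Ax H (.all Ty.nat (.imp (.st (.var .vz)) (.imp A A.step))) →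
      Derives Ax H (.all Ty.nat (.imp (.st (.var .vz)) A))
  | ax {Γ : Ctx} {H : List (Fm Γ)} {A : Fm Γ} : Ax Γ A → Derives Ax H A

/-- Provability (without assumptions) in the base theory with standardness extended by the axioms
`Ax`. -/
def Provable (Ax : ∀ Γ : Ctx, Fm Γ → Prop) {Γ : Ctx} (A : Fm Γ) : Prop := Derives Ax [] A

/-! The functional interpretation. -/

mutual
/-- The types of the tuple `b` in the interpretation `∃̃ˢᵗ b ∀̃ˢᵗ c A_I(b,c)` of `A`. -/
def Fm.wit : {Γ : Ctx} → Fm Γ → List Ty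
  | _, .eq0 _ _ => []
  | _, .st (σ := σ) _ => [σ]
  | _, .bot => []
  | _, .and A B => A.wit ++ B.wit
  | _, .or A B => A.wit ++ B.wit
  | _, .imp A B => (B.wit ++ A.chal.map (arrs B.chal)).map (arrs A.wit)
  | _, .all _ A => A.wit
  | _, .ex _ A => A.wit
/-- The types of the tuple `c` in the interpretation `∃̃ˢᵗ b ∀̃ˢᵗ c A_I(b,c)` of `A`. -/
def Fm.chal : {Γ : Ctx} → Fm Γ → List Ty
  | _, .eq0 _ _ => []
  | _, .st _ => []
  | _, .bot => []
  | _, .and A B => A.chal ++ B.chal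
  | _, .or A B => A.chal ++ B.chal
  | _, .imp A B => A.wit ++ B.chal
  | _, .all _ A => A.chal
  | _, .ex _ A => A.chal
end

/-- The internal formula `A_I(b,c)`, where in addition the substitution `s` is applied to the free
variables of `A`. On internal formulas the tuples are empty and the clauses return the formula
itself. -/
def Fm.inner : {Γ Δ : Ctx} → (A : Fm Γ) → Sub Γ Δ → Tms Δ A.wit → Tms Δ A.chal → Fm Δ
  | _, _, .eq0 t u, s, _, _ => .eq0 (t.subst s) (u.subst s)
  | _, _, .st (σ := σ) t, s, b, _ => maj σ (t.subst s) b.1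
  | _, _, .bot, _, _, _ => .bot
  | _, _, .and A B, s, b, c =>
      .and (A.inner s (Tms.left A.wit b) (Tms.left A.chal c))
        (B.inner s (Tms.right A.wit b) (Tms.right A.chal c))
  | _, _, .or A B, s, b, c =>
      .or
        (allLeMon A.chal (Tms.left A.chal c)
          (A.inner (s.wks A.chal) ((Tms.left A.wit b).wks A.chal) (vars A.chal)))
        (allLeMon B.chal (Tms.right A.chal c)
          (B.inner (s.wks B.chal) ((Tms.right A.wit b).wks B.chal) (vars B.chal)))
  | _, _, .imp A B, s, fg, be =>
      let b : Tms _ A.wit := Tms.left A.wit be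
      let e : Tms _ B.chal := Tms.right A.wit be
      let fgb : Tms _ (B.wit ++ A.chal.map (arrs B.chal)) := Tms.apps A.wit _ fg b
      let fb : Tms _ B.wit := Tms.left B.wit fgb
      let gbe : Tms _ A.chal := Tms.apps B.chal A.chal (Tms.right B.wit fgb) e
      .imp
        (allLeMon A.chal gbe (A.inner (s.wks A.chal) (b.wks A.chal) (vars A.chal)))
        (B.inner s fb e)
  | _, _, .all σ A, s, b, c =>
      .all σ (A.inner (s.lift σ) (Tms.rename (Ren.wk σ) (σs := A.wit) b)
        (Tms.rename (Ren.wk σ) (σs := A.chal) c))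
  | _, _, .ex σ A, s, b, c =>
      .ex σ (allLeMon A.chal (Tms.rename (Ren.wk σ) (σs := A.chal) c)
        (A.inner ((s.lift σ).wks A.chal)
          ((Tms.rename (Ren.wk σ) (σs := A.wit) b).wks A.chal) (vars A.chal)))

/-- The interpretation `∃̃ˢᵗ b ∀̃ˢᵗ c A_I(b,c)` of `A`. -/
def Fm.interp {Γ : Ctx} (A : Fm Γ) : Fm Γ :=
  exStMon A.wit (allStMon A.chal
    (A.inner (((Sub.id Γ).wks A.wit).wks A.chal) ((vars A.wit).wks A.chal) (vars A.chal)))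

end NonstandardHA

-- The proof is by induction on the formula: each characteristic principle moves the prefix `∃̃ˢᵗ b
-- ∀̃ˢᵗ c` past a connective or quantifier.
--
-- Two facts about majorization carry the induction. First, `A_I(b,c)` survives replacing `b` by a
-- majorant when `c` is monotone (`inner_mono`), so a principle that yields only a bound on a
-- witness (choice, realization, independence of premises) in fact yields a witness, namely the
-- bound. Second, the bounded formula `∀̃ c' ≤* c, A_I(b,c')` gets weaker as `c` gets smaller
-- (`innerLe_anti`), and it follows from `∀̃ˢᵗ c, A_I(b,c)` for standard monotone `c`, because
-- anything majorized by a standard element is standard (`innerAll_le`). This is why the bounded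
-- quantifiers in the clauses for `∨`, `→` and `∃` do no harm.
--
-- The cases: `st` is the majorizability axiom in one direction and downward closure of standardness
-- in the other. For `∧` the prefixes merely combine, given that standard monotone tuples of all
-- types exist (`exists_stMon`). For `∀ x`, realization gives one `b` that bounds the witnesses for
-- all `x`. For `∃ x`, idealization gives one `x` that works for all standard `c`. A disjunction is
-- an existential statement about a number `n` that selects a disjunct by `n = 0` or `n ≠ 0`, so
-- idealization applies again, followed by the decidability of `n = 0`. For `→` (`exists_impBody`),
-- independence of premises bounds the witness of the conclusion, Markov's principle replaces the
-- premise by a bounded one for each challenge `e`, and choice makes that bound a function of `e`; a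
-- second choice makes everything a function of `b`.
--
-- Formally, derivability is used in Kripke style. A world is a context with a list of assumptions,
-- `Ext` is passage to a later world along a substitution, and the logical rules are stated so that
-- the bound variable or eigenvariable becomes an arbitrary term of a later world. `Characterized`
-- asserts equiderivability at every world; taking the formula itself as the only assumption turns
-- it into a derivable equivalence.
--
-- The definitions below are made reducible so that, for example, a tuple of type `Tms Δ (A.and
-- B).wit` can be used directly as one of type `Tms Δ (A.wit ++ B.wit)`.

attribute [reducible] NonstandardHA.Tms NonstandardHA.ext NonstandardHA.arrs NonstandardHA.Fm.wit
  NonstandardHA.Fm.chal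

namespace NonstandardHA

/-! The algebra of substitutions. -/

def Sub.ofRen {Γ Δ : Ctx} (r : Ren Γ Δ) : Sub Γ Δ := fun _ x => .var (r _ x)

def Sub.comp {Γ Δ Θ : Ctx} (s : Sub Γ Δ) (u : Sub Δ Θ) : Sub Γ Θ := fun _ x => (s _ x).subst u

/-- Weakening by one variable, as a substitution. -/
def Sub.wk1 {Γ : Ctx} (τ : Ty) : Sub Γ (τ :: Γ) := Sub.ofRen (Ren.wk τ)

/-- Weakening by a tuple of variables, as a substitution. -/
def Sub.wkT {Γ : Ctx} (σs : List Ty) : Sub Γ (ext Γ σs) := Sub.ofRen (Ren.wks σs)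

/-- Extension of a substitution by a tuple of terms. -/
def Sub.conss {Δ : Ctx} : {Γ : Ctx} → {σs : List Ty} → Tms Δ σs → Sub Γ Δ → Sub (ext Γ σs) Δ
  | _, [], _, s => s
  | _, _ :: σs, t, s => Sub.conss (σs := σs) t.2 (Sub.cons t.1 s)

def Sub.lifts : {Γ Δ : Ctx} → Sub Γ Δ → (σs : List Ty) → Sub (ext Γ σs) (ext Δ σs)
  | _, _, s, [] => s
  | _, _, s, σ :: σs => Sub.lifts (s.lift σ) σs

def Tms.subst {Γ Δ : Ctx} (s : Sub Γ Δ) : {σs : List Ty} → Tms Γ σs → Tms Δ σs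
  | [], _ => ()
  | _ :: _, t => (t.1.subst s, Tms.subst s t.2)

theorem Sub.ext {Γ Δ : Ctx} {s u : Sub Γ Δ} (h : ∀ σ x, s σ x = u σ x) : s = u :=
  funext fun σ => funext fun x => h σ x

theorem Sub.ext_cons {Γ Δ : Ctx} {τ : Ty} {s u : Sub (τ :: Γ) Δ} (h0 : s _ .vz = u _ .vz)
    (h1 : ∀ σ x, s σ (.vs x) = u σ (.vs x)) : s = u :=
  Sub.ext fun _ x => match x with
    | .vz => h0
    | .vs x => h1 _ x

theorem Sub.lift_ofRen {Γ Δ : Ctx} (r : Ren Γ Δ) (τ : Ty) :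
    (Sub.ofRen r).lift τ = Sub.ofRen (r.lift τ) :=
  Sub.ext_cons rfl fun _ _ => rfl

/-- With the analogues for formulas and tuples, this eliminates renamings, so that only composition
of substitutions has to be computed. -/
theorem Tm.rename_eq {Γ Δ : Ctx} (r : Ren Γ Δ) {σ : Ty} (t : Tm Γ σ) :
    t.rename r = t.subst (Sub.ofRen r) := by
  induction t <;> simp_all [Tm.rename, Tm.subst, Sub.ofRen]

theorem Fm.rename_eq {Γ Δ : Ctx} (r : Ren Γ Δ) (A : Fm Γ) :
    A.rename r = A.subst (Sub.ofRen r) := by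
  induction A generalizing Δ <;> simp_all [Fm.rename, Fm.subst, Tm.rename_eq, Sub.lift_ofRen]

theorem Tms.rename_eq {Γ Δ : Ctx} (r : Ren Γ Δ) {σs : List Ty} (t : Tms Γ σs) :
    t.rename r = t.subst (Sub.ofRen r) := by
  induction σs with
  | nil => rfl
  | cons σ σs ih => simp [Tms.rename, Tms.subst, Tm.rename_eq, ih]

theorem Sub.rename_eq {Γ Δ Θ : Ctx} (s : Sub Γ Δ) (r : Ren Δ Θ) :
    s.rename r = s.comp (Sub.ofRen r) :=
  Sub.ext fun _ _ => Tm.rename_eq _ _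

theorem Sub.lift_eq {Γ Δ : Ctx} (s : Sub Γ Δ) (τ : Ty) :
    s.lift τ = Sub.cons (.var .vz) (s.comp (Sub.wk1 τ)) := by
  rw [Sub.lift, Sub.rename_eq, Sub.wk1]

@[simp] theorem Sub.wk1_comp_cons {Γ Δ : Ctx} {τ : Ty} (t : Tm Δ τ) (s : Sub Γ Δ) :
    (Sub.wk1 τ).comp (Sub.cons t s) = s := rfl

theorem Tm.subst_subst {Γ Δ Θ : Ctx} (s : Sub Γ Δ) (u : Sub Δ Θ) {σ : Ty} (t : Tm Γ σ) :
    (t.subst s).subst u = t.subst (s.comp u) := by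
  induction t <;> simp_all [Tm.subst, Sub.comp]

theorem Sub.comp_assoc {Γ Δ Θ Ξ : Ctx} (s : Sub Γ Δ) (u : Sub Δ Θ) (v : Sub Θ Ξ) :
    (s.comp u).comp v = s.comp (u.comp v) :=
  Sub.ext fun _ _ => Tm.subst_subst _ _ _

@[simp] theorem Sub.cons_comp {Γ Δ Θ : Ctx} {τ : Ty} (t : Tm Δ τ) (s : Sub Γ Δ) (u : Sub Δ Θ) :
    (Sub.cons t s).comp u = Sub.cons (t.subst u) (s.comp u) :=
  Sub.ext_cons rfl fun _ _ => rfl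

@[simp] theorem Tm.app_subst {Γ Δ : Ctx} {σ τ : Ty} (f : Tm Γ (.arr σ τ)) (t : Tm Γ σ)
    (s : Sub Γ Δ) : (Tm.app f t).subst s = .app (f.subst s) (t.subst s) := rfl

@[simp] theorem Tm.zero_subst {Γ Δ : Ctx} (s : Sub Γ Δ) : Tm.zero.subst s = .zero := rfl

@[simp] theorem Tm.succ_subst {Γ Δ : Ctx} (s : Sub Γ Δ) : Tm.succ.subst s = .succ := rfl

@[simp] theorem Tm.var_vz_subst_cons {Γ Δ : Ctx} {τ : Ty} (t : Tm Δ τ) (s : Sub Γ Δ) :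
    (Tm.var .vz).subst (Sub.cons t s) = t := rfl

@[simp] theorem Tm.var_vs_subst_cons {Γ Δ : Ctx} {σ τ : Ty} (t : Tm Δ τ) (s : Sub Γ Δ)
    (x : Var Γ σ) : (Tm.var (.vs x)).subst (Sub.cons t s) = (Tm.var x).subst s := rfl

theorem Sub.lift_comp {Γ Δ Θ : Ctx} (s : Sub Γ Δ) (u : Sub Δ Θ) (τ : Ty) :
    (s.lift τ).comp (u.lift τ) = (s.comp u).lift τ := by
  simp [Sub.lift_eq, Sub.comp_assoc]

theorem Fm.subst_subst {Γ Δ Θ : Ctx} (s : Sub Γ Δ) (u : Sub Δ Θ) (A : Fm Γ) :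
    (A.subst s).subst u = A.subst (s.comp u) := by
  induction A generalizing Δ Θ <;> simp_all [Fm.subst, Tm.subst_subst, Sub.lift_comp]

theorem Tms.subst_subst {Γ Δ Θ : Ctx} (s : Sub Γ Δ) (u : Sub Δ Θ) {σs : List Ty} (t : Tms Γ σs) :
    (t.subst s).subst u = t.subst (s.comp u) := by
  induction σs with
  | nil => rfl
  | cons σ σs ih => simp [Tms.subst, Tm.subst_subst, ih]

@[simp] theorem Tm.subst_id {Γ : Ctx} {σ : Ty} (t : Tm Γ σ) : t.subst (Sub.id Γ) = t := by
  induction t <;> simp_all [Tm.subst, Sub.id]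

@[simp] theorem Tms.subst_id {Γ : Ctx} {σs : List Ty} (t : Tms Γ σs) :
    t.subst (Sub.id Γ) = t := by
  induction σs with
  | nil => rfl
  | cons σ σs ih => simp [Tms.subst, ih]

@[simp] theorem Sub.cons_vz_wk1 {Γ : Ctx} (τ : Ty) :
    Sub.cons (.var .vz) (Sub.wk1 τ) = Sub.id (τ :: Γ) :=
  Sub.ext_cons rfl fun _ _ => rfl

/-- Used in the block rules to fold the first variable of a block back into the substitution that
moved it to a later world. -/
theorem Sub.cons_eta {Γ Δ : Ctx} {τ : Ty} (s : Sub (τ :: Γ) Δ) :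
    Sub.cons (s _ .vz) ((Sub.wk1 τ).comp s) = s :=
  Sub.ext_cons rfl fun _ _ => rfl

@[simp] theorem Sub.id_comp {Γ Δ : Ctx} (s : Sub Γ Δ) : (Sub.id Γ).comp s = s := rfl

@[simp] theorem Sub.comp_id {Γ Δ : Ctx} (s : Sub Γ Δ) : s.comp (Sub.id Δ) = s :=
  Sub.ext fun _ _ => Tm.subst_id _

theorem Sub.lift_id {Γ : Ctx} (τ : Ty) : (Sub.id Γ).lift τ = Sub.id (τ :: Γ) := by
  simp [Sub.lift_eq]

@[simp] theorem Fm.subst_id {Γ : Ctx} (A : Fm Γ) : A.subst (Sub.id Γ) = A := by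
  induction A <;> simp_all [Fm.subst, Sub.lift_id]

theorem Fm.wk_eq {Γ : Ctx} (τ : Ty) (A : Fm Γ) : A.wk τ = A.subst (Sub.wk1 τ) := Fm.rename_eq _ _

theorem Tm.wk_eq {Γ : Ctx} {σ : Ty} (τ : Ty) (t : Tm Γ σ) : t.wk τ = t.subst (Sub.wk1 τ) :=
  Tm.rename_eq _ _

theorem Sub.wkT_cons {Γ : Ctx} (σ : Ty) (σs : List Ty) :
    Sub.wkT (Γ := Γ) (σ :: σs) = (Sub.wk1 σ).comp (Sub.wkT σs) := rfl

theorem vars_cons {Γ : Ctx} (σ : Ty) (σs : List Ty) :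
    vars (Γ := Γ) (σ :: σs) = ((Tm.var .vz).subst (Sub.wkT σs), vars σs) := rfl

@[simp] theorem Sub.wkT_comp_conss {Γ Δ : Ctx} {σs : List Ty} (t : Tms Δ σs) (s : Sub Γ Δ) :
    (Sub.wkT σs).comp (Sub.conss t s) = s := by
  induction σs generalizing Γ with
  | nil => rfl
  | cons σ σs ih => rw [Sub.wkT_cons, Sub.comp_assoc, Sub.conss, ih (Γ := σ :: Γ)]; rfl

@[simp] theorem vars_subst_conss {Γ Δ : Ctx} {σs : List Ty} (t : Tms Δ σs) (s : Sub Γ Δ) :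
    (vars σs).subst (Sub.conss t s) = t := by
  induction σs generalizing Γ with
  | nil => rfl
  | cons σ σs ih =>
    rw [vars_cons, Tms.subst, Sub.conss, ih (Γ := σ :: Γ), Tm.subst_subst,
      Sub.wkT_comp_conss (Γ := σ :: Γ)]; rfl

@[simp] theorem Sub.conss_comp {Γ Δ Θ : Ctx} {σs : List Ty} (t : Tms Δ σs) (s : Sub Γ Δ)
    (u : Sub Δ Θ) : (Sub.conss t s).comp u = Sub.conss (t.subst u) (s.comp u) := by
  induction σs generalizing Γ with
  | nil => rfl
  | cons σ σs ih => simp [Sub.conss, ih, Tms.subst]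

/-- The normal form for passing under a block: once lifts are written with `Sub.conss`, all
substitution identities below reduce to `Sub.conss_comp`, `Sub.wkT_comp_conss` and
`vars_subst_conss`. -/
theorem Sub.lifts_eq {Γ Δ : Ctx} (s : Sub Γ Δ) (σs : List Ty) :
    s.lifts σs = Sub.conss (vars σs) (s.comp (Sub.wkT σs)) := by
  induction σs generalizing Γ Δ with
  | nil => exact (Sub.comp_id s).symm
  | cons σ σs ih =>
    rw [Sub.lifts, ih, Sub.lift_eq, Sub.cons_comp, vars_cons, Sub.conss, Sub.wkT_cons,
      Sub.comp_assoc]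

theorem Sub.ofRen_lifts {Γ Δ : Ctx} (r : Ren Γ Δ) (σs : List Ty) :
    Sub.ofRen (r.lifts σs) = (Sub.ofRen r).lifts σs := by
  induction σs generalizing Γ Δ with
  | nil => rfl
  | cons σ σs ih => rw [Ren.lifts, ih, Sub.lifts, Sub.lift_ofRen]

theorem Sub.ofRen_wks {Γ : Ctx} (σs : List Ty) : Sub.ofRen (Ren.wks (Γ := Γ) σs) = Sub.wkT σs := rfl

theorem Sub.ofRen_wk {Γ : Ctx} (σ : Ty) : Sub.ofRen (Ren.wk (Γ := Γ) σ) = Sub.wk1 σ := rfl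

theorem Sub.wks_eq {Γ Δ : Ctx} (σs : List Ty) (s : Sub Γ Δ) : s.wks σs = s.comp (Sub.wkT σs) :=
  Sub.rename_eq _ _

theorem Tms.wks_eq {Γ : Ctx} (σs : List Ty) {τs : List Ty} (t : Tms Γ τs) :
    t.wks σs = t.subst (Sub.wkT σs) := Tms.rename_eq _ _

theorem Fm.wks_eq {Γ : Ctx} (σs : List Ty) (A : Fm Γ) : A.wks σs = A.subst (Sub.wkT σs) :=
  Fm.rename_eq _ _

theorem Fm.inst_subst {Γ Δ : Ctx} {σ : Ty} (A : Fm (σ :: Γ)) (t : Tm Γ σ) (s : Sub Γ Δ) :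
    (A.inst t).subst s = (A.subst (s.lift σ)).inst (t.subst s) := by
  simp [Fm.inst, Fm.subst_subst, Sub.lift_eq, Sub.comp_assoc, Tm.subst, Sub.cons]

theorem Fm.step_subst {Γ Δ : Ctx} (A : Fm (Ty.nat :: Γ)) (s : Sub Γ Δ) :
    A.step.subst (s.lift _) = (A.subst (s.lift _)).step := by
  simp [Fm.step, Fm.subst_subst, Sub.lift_eq, Sub.comp_assoc, Tm.subst, Sub.cons, Sub.rename_eq,
    Sub.ofRen_wk]

theorem Tm.wk_subst {Γ Δ : Ctx} {σ τ : Ty} (t : Tm Γ σ) (s : Sub Γ Δ) :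
    (t.wk τ).subst (s.lift τ) = (t.subst s).wk τ := by
  simp [Tm.wk_eq, Tm.subst_subst, Sub.lift_eq]

theorem Fm.wk_subst {Γ Δ : Ctx} {τ : Ty} (A : Fm Γ) (s : Sub Γ Δ) :
    (A.wk τ).subst (s.lift τ) = (A.subst s).wk τ := by
  simp [Fm.wk_eq, Fm.subst_subst, Sub.lift_eq]

theorem Tms.rename_wk_subst {Γ Δ : Ctx} {σs : List Ty} {τ : Ty} (t : Tms Γ σs) (s : Sub Γ Δ) :
    (t.rename (Ren.wk τ)).subst (s.lift τ) = (t.subst s).rename (Ren.wk τ) := by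
  simp [Tms.rename_eq, Tms.subst_subst, Sub.lift_eq, Sub.ofRen_wk]

theorem Sub.lift_vz {Γ Δ : Ctx} {τ : Ty} (s : Sub Γ Δ) : s.lift τ _ .vz = .var .vz := rfl

theorem Tm.var_vz_subst_lift {Γ Δ : Ctx} {τ : Ty} (s : Sub Γ Δ) :
    (Tm.var .vz).subst (s.lift τ) = .var .vz := rfl

theorem eq_subst {Γ Δ : Ctx} {σ : Ty} (t u : Tm Γ σ) (s : Sub Γ Δ) :
    (eq σ t u).subst s = eq σ (t.subst s) (u.subst s) := by
  induction σ generalizing Γ Δ with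
  | nat => rfl
  | arr σ τ _ ih =>
    simp [eq, Fm.subst, ih, Tm.subst, Tm.wk_subst, Sub.lift_vz]

theorem Tm.add_subst {Γ Δ : Ctx} (t u : Tm Γ Ty.nat) (s : Sub Γ Δ) :
    (t.add u).subst s = (t.subst s).add (u.subst s) := rfl

theorem le0_subst {Γ Δ : Ctx} (t u : Tm Γ Ty.nat) (s : Sub Γ Δ) :
    (le0 t u).subst s = le0 (t.subst s) (u.subst s) := by
  simp [le0, Fm.subst, Tm.add_subst, Tm.wk_subst, Tm.var_vz_subst_lift]

theorem maj_subst {Γ Δ : Ctx} {σ : Ty} (t u : Tm Γ σ) (s : Sub Γ Δ) :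
    (maj σ t u).subst s = maj σ (t.subst s) (u.subst s) := by
  induction σ generalizing Γ Δ with
  | nat => exact le0_subst _ _ _
  | arr σ τ ih₁ ih₂ =>
    simp only [maj, Fm.subst, ih₁, ih₂, Tm.subst, Tm.wk_subst]
    rfl

theorem mon_subst {Γ Δ : Ctx} {σ : Ty} (t : Tm Γ σ) (s : Sub Γ Δ) :
    (mon t).subst s = mon (t.subst s) := maj_subst _ _ _

-- Substitution through quantifier blocks and tuple operations.

section Blocks
variable {Γ Δ : Ctx} (s : Sub Γ Δ) {σs : List Ty}

theorem allT_subst (A : Fm (ext Γ σs)) :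
    (allT σs A).subst s = allT σs (A.subst (s.lifts σs)) := by
  induction σs generalizing Γ Δ with
  | nil => rfl
  | cons σ σs ih => simp [allT, Fm.subst, ih, Sub.lifts]

theorem exT_subst (A : Fm (ext Γ σs)) :
    (exT σs A).subst s = exT σs (A.subst (s.lifts σs)) := by
  induction σs generalizing Γ Δ with
  | nil => rfl
  | cons σ σs ih => simp [exT, Fm.subst, ih, Sub.lifts]

theorem allSt_subst (A : Fm (ext Γ σs)) :
    (allSt σs A).subst s = allSt σs (A.subst (s.lifts σs)) := by
  induction σs generalizing Γ Δ with
  | nil => rfl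
  | cons σ σs ih => simp [allSt, Fm.subst, ih, Sub.lifts, Tm.var_vz_subst_lift]

theorem exSt_subst (A : Fm (ext Γ σs)) :
    (exSt σs A).subst s = exSt σs (A.subst (s.lifts σs)) := by
  induction σs generalizing Γ Δ with
  | nil => rfl
  | cons σ σs ih => simp [exSt, Fm.subst, ih, Sub.lifts, Tm.var_vz_subst_lift]

theorem allStMon_subst (A : Fm (ext Γ σs)) :
    (allStMon σs A).subst s = allStMon σs (A.subst (s.lifts σs)) := by
  induction σs generalizing Γ Δ with
  | nil => rfl
  | cons σ σs ih => simp [allStMon, Fm.subst, ih, Sub.lifts, Tm.var_vz_subst_lift, mon_subst]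

theorem exStMon_subst (A : Fm (ext Γ σs)) :
    (exStMon σs A).subst s = exStMon σs (A.subst (s.lifts σs)) := by
  induction σs generalizing Γ Δ with
  | nil => rfl
  | cons σ σs ih => simp [exStMon, Fm.subst, ih, Sub.lifts, Tm.var_vz_subst_lift, mon_subst]

theorem allLe_subst (t : Tms Γ σs) (A : Fm (ext Γ σs)) :
    (allLe σs t A).subst s = allLe σs (t.subst s) (A.subst (s.lifts σs)) := by
  induction σs generalizing Γ Δ with
  | nil => rfl
  | cons σ σs ih =>
    simp [allLe, Fm.subst, ih, Sub.lifts, Tm.var_vz_subst_lift, maj_subst, Tms.subst,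
      Tm.wk_subst, Tms.rename_wk_subst]

theorem exLe_subst (t : Tms Γ σs) (A : Fm (ext Γ σs)) :
    (exLe σs t A).subst s = exLe σs (t.subst s) (A.subst (s.lifts σs)) := by
  induction σs generalizing Γ Δ with
  | nil => rfl
  | cons σ σs ih =>
    simp [exLe, Fm.subst, ih, Sub.lifts, Tm.var_vz_subst_lift, maj_subst, Tms.subst,
      Tm.wk_subst, Tms.rename_wk_subst]

theorem allLeMon_subst (t : Tms Γ σs) (A : Fm (ext Γ σs)) :
    (allLeMon σs t A).subst s = allLeMon σs (t.subst s) (A.subst (s.lifts σs)) := by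
  induction σs generalizing Γ Δ with
  | nil => rfl
  | cons σ σs ih =>
    simp [allLeMon, Fm.subst, ih, Sub.lifts, Tm.var_vz_subst_lift, maj_subst, Tms.subst,
      Tm.wk_subst, Tms.rename_wk_subst, mon_subst]

theorem exLeMon_subst (t : Tms Γ σs) (A : Fm (ext Γ σs)) :
    (exLeMon σs t A).subst s = exLeMon σs (t.subst s) (A.subst (s.lifts σs)) := by
  induction σs generalizing Γ Δ with
  | nil => rfl
  | cons σ σs ih =>
    simp [exLeMon, Fm.subst, ih, Sub.lifts, Tm.var_vz_subst_lift, maj_subst, Tms.subst,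
      Tm.wk_subst, Tms.rename_wk_subst, mon_subst]

theorem Tms.left_subst {τs : List Ty} (t : Tms Γ (σs ++ τs)) :
    (Tms.left σs t).subst s = Tms.left σs (t.subst s) := by
  induction σs with
  | nil => rfl
  | cons σ σs ih => simp [Tms.left, Tms.subst, ih]

theorem Tms.right_subst {τs : List Ty} (t : Tms Γ (σs ++ τs)) :
    (Tms.right σs t).subst s = Tms.right σs (t.subst s) := by
  induction σs with
  | nil => rfl
  | cons σ σs ih => simp [Tms.right, Tms.subst, ih]

theorem Tm.apps_subst {τ : Ty} (f : Tm Γ (arrs σs τ)) (t : Tms Γ σs) :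
    (Tm.apps σs f t).subst s = Tm.apps σs (f.subst s) (t.subst s) := by
  induction σs with
  | nil => rfl
  | cons σ σs ih => simp [Tm.apps, Tms.subst, ih, Tm.subst]

theorem Tms.apps_subst {τs : List Ty} (f : Tms Γ (τs.map (arrs σs))) (t : Tms Γ σs) :
    (Tms.apps σs τs f t).subst s = Tms.apps σs τs (f.subst s) (t.subst s) := by
  induction τs with
  | nil => rfl
  | cons τ τs ih => simp [Tms.apps, Tms.subst, ih, Tm.apps_subst]

end Blocks

/-- Concatenation of tuples. -/
def Tms.append {Γ : Ctx} : {σs τs : List Ty} → Tms Γ σs → Tms Γ τs → Tms Γ (σs ++ τs)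
  | [], _, _, u => u
  | _ :: _, _, t, u => (t.1, Tms.append t.2 u)

@[simp] theorem Tms.left_append {Γ : Ctx} {σs τs : List Ty} (t : Tms Γ σs) (u : Tms Γ τs) :
    Tms.left σs (t.append u) = t := by
  induction σs with
  | nil => rfl
  | cons σ σs ih => simp [Tms.left, Tms.append, ih]

@[simp] theorem Tms.right_append {Γ : Ctx} {σs τs : List Ty} (t : Tms Γ σs) (u : Tms Γ τs) :
    Tms.right σs (t.append u) = u := by
  induction σs with
  | nil => rfl
  | cons σ σs ih => simp [Tms.right, Tms.append, ih]

theorem Tms.append_subst {Γ Δ : Ctx} {σs τs : List Ty} (t : Tms Γ σs) (u : Tms Γ τs)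
    (s : Sub Γ Δ) : (t.append u).subst s = (t.subst s).append (u.subst s) := by
  induction σs with
  | nil => rfl
  | cons σ σs ih => simp [Tms.append, Tms.subst, ih]

/-! Substitution in the interpretation. -/

section Inner
variable {Γ Δ : Ctx} (A B : Fm Γ) (s : Sub Γ Δ)

theorem Fm.inner_and (b : Tms Δ (A.wit ++ B.wit)) (c : Tms Δ (A.chal ++ B.chal)) :
    (A.and B).inner s b c = .and (A.inner s (Tms.left A.wit b) (Tms.left A.chal c))
        (B.inner s (Tms.right A.wit b) (Tms.right A.chal c)) := rfl

theorem Fm.inner_or (b : Tms Δ (A.wit ++ B.wit)) (c : Tms Δ (A.chal ++ B.chal)) :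
    (A.or B).inner s b c = .or
        (allLeMon A.chal (Tms.left A.chal c) (A.inner (s.comp (Sub.wkT A.chal))
          ((Tms.left A.wit b).subst (Sub.wkT A.chal)) (vars A.chal)))
        (allLeMon B.chal (Tms.right A.chal c) (B.inner (s.comp (Sub.wkT B.chal))
          ((Tms.right A.wit b).subst (Sub.wkT B.chal)) (vars B.chal))) := by
  simp only [← Sub.wks_eq, ← Tms.wks_eq]; rfl

theorem Fm.inner_imp (fg : Tms Δ ((B.wit ++ A.chal.map (arrs B.chal)).map (arrs A.wit)))
    (be : Tms Δ (A.wit ++ B.chal)) :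
    (A.imp B).inner s fg be = .imp
        (allLeMon A.chal
          (Tms.apps B.chal A.chal
            (Tms.right B.wit (Tms.apps A.wit _ fg (Tms.left A.wit be))) (Tms.right A.wit be))
          (A.inner (s.comp (Sub.wkT A.chal))
            ((Tms.left A.wit be).subst (Sub.wkT A.chal)) (vars A.chal)))
        (B.inner s (Tms.left B.wit (Tms.apps A.wit _ fg (Tms.left A.wit be)))
          (Tms.right A.wit be)) := by
  simp only [← Sub.wks_eq, ← Tms.wks_eq]; rfl

theorem Fm.inner_all {σ : Ty} (A : Fm (σ :: Γ)) (b : Tms Δ A.wit) (c : Tms Δ A.chal) :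
    (Fm.all σ A).inner s b c =
      .all σ (A.inner (s.lift σ) (b.subst (Sub.wk1 σ)) (c.subst (Sub.wk1 σ))) := by
  simp only [Sub.wk1, ← Tms.rename_eq]; rfl

theorem Fm.inner_ex {σ : Ty} (A : Fm (σ :: Γ)) (b : Tms Δ A.wit) (c : Tms Δ A.chal) :
    (Fm.ex σ A).inner s b c =
      .ex σ (allLeMon A.chal (c.subst (Sub.wk1 σ))
        (A.inner ((s.lift σ).comp (Sub.wkT A.chal))
          ((b.subst (Sub.wk1 σ)).subst (Sub.wkT A.chal)) (vars A.chal))) := by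
  simp only [← Sub.wks_eq, ← Tms.wks_eq, Sub.wk1, ← Tms.rename_eq]; rfl

end Inner

/-- Because `inner` carries its own substitution for the free variables, a later substitution is
absorbed into its three arguments; the formula `A` itself never changes, so induction on `A` stays
available at every world. -/
theorem Fm.inner_subst {Γ Δ Θ : Ctx} (A : Fm Γ) (s : Sub Γ Δ) (b : Tms Δ A.wit)
    (c : Tms Δ A.chal) (u : Sub Δ Θ) :
    (A.inner s b c).subst u = A.inner (s.comp u) (b.subst u) (c.subst u) := by
  induction A generalizing Δ Θ with
  | eq0 t v => simp [Fm.inner, Fm.subst, Tm.subst_subst]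
  | st t => simp only [Fm.inner, maj_subst, Tm.subst_subst]; rfl
  | bot => rfl
  | and A B ihA ihB =>
    refine Eq.trans ?_ (Fm.inner_and A B _ _ _).symm
    rw [Fm.inner_and, Fm.subst, ihA, ihB]
    simp only [Tms.left_subst, Tms.right_subst]
  | or A B ihA ihB =>
    refine Eq.trans ?_ (Fm.inner_or A B _ _ _).symm
    rw [Fm.inner_or, Fm.subst, allLeMon_subst, allLeMon_subst, ihA, ihB]
    simp [Tms.left_subst, Tms.right_subst, Sub.comp_assoc, Tms.subst_subst, Sub.lifts_eq]
  | imp A B ihA ihB =>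
    refine Eq.trans ?_ (Fm.inner_imp A B _ _ _).symm
    rw [Fm.inner_imp, Fm.subst, allLeMon_subst, ihA, ihB]
    simp [Tms.left_subst, Tms.right_subst, Sub.comp_assoc, Tms.subst_subst, Sub.lifts_eq,
      Tms.apps_subst]
  | all σ A ih =>
    refine Eq.trans ?_ (Fm.inner_all _ A _ _).symm
    rw [Fm.inner_all, Fm.subst, ih]
    simp [Tms.subst_subst, Sub.lift_comp]
    simp [Sub.lift_eq]
  | ex σ A ih =>
    refine Eq.trans ?_ (Fm.inner_ex _ A _ _).symm
    rw [Fm.inner_ex, Fm.subst, allLeMon_subst, ih]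
    simp [Tms.subst_subst, Sub.comp_assoc, Sub.lift_eq, Sub.lifts_eq, Tm.subst_subst]

/-! Derivability is closed under substitution. -/

theorem Fm.Internal.subst {Γ Δ : Ctx} {A : Fm Γ} (h : A.Internal) (s : Sub Γ Δ) :
    (A.subst s).Internal := by
  induction A generalizing Δ with
  | and A B ihA ihB => exact ⟨ihA h.1 s, ihB h.2 s⟩
  | or A B ihA ihB => exact ⟨ihA h.1 s, ihB h.2 s⟩
  | imp A B ihA ihB => exact ⟨ihA h.1 s, ihB h.2 s⟩
  | all σ A ih => exact ih h _
  | ex σ A ih => exact ih h _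
  | st t => exact h
  | _ => trivial

theorem EHA.subst {Γ Δ : Ctx} {A : Fm Γ} (h : EHA A) (s : Sub Γ Δ) : EHA (A.subst s) := by
  cases h with
  | eq_refl t => exact .eq_refl _
  | eq_symm t u => exact .eq_symm _ _
  | eq_trans t u v => exact .eq_trans _ _ _
  | extensionality f t u =>
    simp only [Fm.subst, eq_subst, Tm.subst]; exact .extensionality _ _ _
  | succ_ne_zero t => exact .succ_ne_zero _
  | succ_inj t u => exact .succ_inj _ _
  | K_eq t u => simp only [eq_subst, Tm.subst]; exact .K_eq _ _
  | S_eq t u v => simp only [eq_subst, Tm.subst]; exact .S_eq _ _ _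
  | R_zero t u => simp only [eq_subst, Tm.subst]; exact .R_zero _ _
  | R_succ n t u => simp only [eq_subst, Tm.subst]; exact .R_succ _ _ _
  | induction A hA =>
    simp only [Fm.subst, Fm.inst_subst, Fm.step_subst, Tm.subst]
    exact .induction _ (hA.subst _)

theorem StAx.subst {Γ Δ : Ctx} {A : Fm Γ} (h : StAx A) (s : Sub Γ Δ) : StAx (A.subst s) := by
  cases h with
  | eq t u => simp only [Fm.subst, eq_subst]; exact .eq _ _
  | maj t u => simp only [Fm.subst, maj_subst]; exact .maj _ _
  | closed t =>
    have : (t.rename (Ren.empty Γ)).subst s = t.rename (Ren.empty Δ) := by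
      rw [Tm.rename_eq, Tm.rename_eq, Tm.subst_subst]
      congr 1
      exact Sub.ext fun _ x => nomatch x
    rw [Fm.subst, this]
    exact .closed t
  | app f t => exact .app _ _

-- Stability of the characteristic principles under substitution.

section
variable {Γ Δ : Ctx} (s : Sub Γ Δ) {σs τs : List Ty}

theorem mAC_subst (A : Fm (ext (ext Γ σs) τs)) :
    (mAC σs τs A).subst s = mAC σs τs (A.subst ((s.lifts σs).lifts τs)) := by
  simp [mAC, Fm.subst, allStMon_subst, exStMon_subst, exLeMon_subst, Tms.apps_subst,
    Fm.rename_eq, Fm.subst_subst, Sub.ofRen_lifts, Sub.lifts_eq, Sub.ofRen_wks, Tms.wks_eq,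
    Tms.subst_subst, Sub.comp_assoc]

theorem Realization_subst (A : Fm (ext (ext Γ σs) τs)) :
    (Realization σs τs A).subst s = Realization σs τs (A.subst ((s.lifts σs).lifts τs)) := by
  simp [Realization, Fm.subst, allT_subst, exSt_subst, exStMon_subst, exLe_subst,
    Fm.rename_eq, Fm.subst_subst, Sub.ofRen_lifts, Sub.lifts_eq, Sub.ofRen_wks, Tms.wks_eq,
    Tms.subst_subst, Sub.comp_assoc]

theorem Idealization_subst (A : Fm (ext (ext Γ σs) τs)) :
    (Idealization σs τs A).subst s = Idealization σs τs (A.subst ((s.lifts σs).lifts τs)) := by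
  simp [Idealization, Fm.subst, exT_subst, allSt_subst, allStMon_subst, allLe_subst,
    Fm.rename_eq, Fm.subst_subst, Sub.ofRen_lifts, Sub.lifts_eq, Sub.ofRen_wks, Tms.wks_eq,
    Tms.subst_subst, Sub.comp_assoc]

theorem IP_subst (A : Fm (ext Γ σs)) (B : Fm (ext Γ τs)) :
    (IP σs τs A B).subst s = IP σs τs (A.subst (s.lifts σs)) (B.subst (s.lifts τs)) := by
  simp [IP, Fm.subst, exStMon_subst, allStMon_subst, exLeMon_subst, Fm.wks_eq,
    Fm.rename_eq, Fm.subst_subst, Sub.ofRen_lifts, Sub.lifts_eq, Sub.ofRen_wks,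
    Sub.comp_assoc]

theorem MP_subst (A : Fm (ext Γ σs)) (B : Fm Γ) :
    (MP σs A B).subst s = MP σs (A.subst (s.lifts σs)) (B.subst s) := by
  simp [MP, Fm.subst, exStMon_subst, allStMon_subst, allLeMon_subst, Fm.wks_eq,
    Fm.rename_eq, Fm.subst_subst, Sub.ofRen_lifts, Sub.lifts_eq, Sub.ofRen_wks,
    Sub.comp_assoc]

theorem MAJ_subst (σ : Ty) : (MAJ σ).subst s = MAJ σ := by
  simp only [MAJ, Fm.subst, maj_subst]; rfl

end

theorem CharAx.subst {Γ Δ : Ctx} {A : Fm Γ} (h : CharAx A) (s : Sub Γ Δ) :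
    CharAx (A.subst s) := by
  cases h with
  | mAC σs τs A => rw [mAC_subst]; exact .mAC _ _ _
  | R σs τs A => rw [Realization_subst]; exact .R _ _ _
  | I σs τs A hA => rw [Idealization_subst]; exact .I _ _ _ (hA.subst _)
  | IP σs τs A hA B => rw [IP_subst]; exact .IP _ _ _ (hA.subst _) _
  | MP σs A hA B hB => rw [MP_subst]; exact .MP _ _ (hA.subst _) _ (hB.subst _)
  | MAJ σ => rw [MAJ_subst]; exact .MAJ _

/-- Derivability in the full system. -/
abbrev D {Γ : Ctx} (H : List (Fm Γ)) (A : Fm Γ) : Prop := Derives (fun _ A => CharAx A) H A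

/-- All axioms are schemas in arbitrary terms and formulas, hence closed under substitution; under a
binder the substitution is lifted, which commutes with weakening of the assumptions. -/
theorem D.subst {Γ Δ : Ctx} {H : List (Fm Γ)} {A : Fm Γ} (h : D H A) (s : Sub Γ Δ) :
    D (H.map (Fm.subst s)) (A.subst s) := by
  have key : ∀ {Γ Δ : Ctx} (H : List (Fm Γ)) (s : Sub Γ Δ) (σ : Ty),
      (H.map (Fm.wk σ)).map (Fm.subst (s.lift σ)) = (H.map (Fm.subst s)).map (Fm.wk σ) := by
    intro Γ Δ H s σ; simp [Function.comp_def, Fm.wk_subst]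
  induction h generalizing Δ with
  | hyp h => exact .hyp (List.mem_map_of_mem h)
  | botE _ ih => exact .botE (ih s)
  | andI _ _ ih₁ ih₂ => exact .andI (ih₁ s) (ih₂ s)
  | andE₁ _ ih => exact .andE₁ (ih s)
  | andE₂ _ ih => exact .andE₂ (ih s)
  | orI₁ _ ih => exact .orI₁ (ih s)
  | orI₂ _ ih => exact .orI₂ (ih s)
  | orE _ _ _ ih ih₁ ih₂ => exact .orE (ih s) (ih₁ s) (ih₂ s)
  | impI _ ih => exact .impI (ih s)
  | impE _ _ ih₁ ih₂ => exact .impE (ih₁ s) (ih₂ s)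
  | allI _ ih => exact .allI (key _ s _ ▸ ih (s.lift _))
  | allE t _ ih => rw [Fm.inst_subst]; exact .allE _ (ih s)
  | exI t _ ih => exact .exI (t.subst s) (Fm.inst_subst _ _ _ ▸ ih s)
  | exE _ _ ih₁ ih₂ =>
    refine .exE (ih₁ s) ?_
    have := ih₂ (s.lift _)
    rwa [List.map_cons, key, Fm.wk_subst] at this
  | eha h => exact .eha (h.subst s)
  | stAx h => exact .stAx (h.subst s)
  | extInd _ _ ih₁ ih₂ =>
    have h₁ := ih₁ s
    have h₂ := ih₂ s
    rw [Fm.inst_subst] at h₁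
    simp only [Fm.subst, Fm.step_subst] at h₂
    exact .extInd h₁ h₂
  | ax h => exact .ax (CharAx.subst h s)

theorem D.weaken {Γ : Ctx} {H H' : List (Fm Γ)} {A : Fm Γ} (h : D H A) (hs : H ⊆ H') :
    D H' A := by
  induction h with
  | hyp h => exact .hyp (hs h)
  | botE _ ih => exact .botE (ih hs)
  | andI _ _ ih₁ ih₂ => exact .andI (ih₁ hs) (ih₂ hs)
  | andE₁ _ ih => exact .andE₁ (ih hs)
  | andE₂ _ ih => exact .andE₂ (ih hs)
  | orI₁ _ ih => exact .orI₁ (ih hs)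
  | orI₂ _ ih => exact .orI₂ (ih hs)
  | orE _ _ _ ih ih₁ ih₂ =>
    exact .orE (ih hs) (ih₁ (List.cons_subset_cons _ hs)) (ih₂ (List.cons_subset_cons _ hs))
  | impI _ ih => exact .impI (ih (List.cons_subset_cons _ hs))
  | impE _ _ ih₁ ih₂ => exact .impE (ih₁ hs) (ih₂ hs)
  | allI _ ih => exact .allI (ih (List.map_subset _ hs))
  | allE t _ ih => exact .allE t (ih hs)
  | exI t _ ih => exact .exI t (ih hs)
  | exE _ _ ih₁ ih₂ => exact .exE (ih₁ hs) (ih₂ (List.cons_subset_cons _ (List.map_subset _ hs)))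
  | eha h => exact .eha h
  | stAx h => exact .stAx h
  | extInd _ _ ih₁ ih₂ => exact .extInd (ih₁ hs) (ih₂ hs)
  | ax h => exact .ax h

/-- The assumptions `H'` extend `H`, along the substitution `u`. -/
def Ext {Γ Δ : Ctx} (H : List (Fm Γ)) (H' : List (Fm Δ)) (u : Sub Γ Δ) : Prop :=
  H.map (Fm.subst u) ⊆ H'

/-- Persistence: what is derivable at a world stays derivable at every later one. -/
theorem D.mono {Γ Δ : Ctx} {H : List (Fm Γ)} {H' : List (Fm Δ)} {u : Sub Γ Δ} {A : Fm Γ}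
    (h : D H A) (e : Ext H H' u) : D H' (A.subst u) := (h.subst u).weaken e

theorem Ext.of_subset {Γ : Ctx} {H H' : List (Fm Γ)} (h : H ⊆ H') : Ext H H' (Sub.id Γ) := by
  have : (Fm.subst (Sub.id Γ)) = (fun A : Fm Γ => A) := funext Fm.subst_id
  simpa [Ext, this] using h

theorem Ext.refl {Γ : Ctx} (H : List (Fm Γ)) : Ext H H (Sub.id Γ) := .of_subset fun _ h => h

theorem Ext.trans {Γ Δ Θ : Ctx} {H : List (Fm Γ)} {H' : List (Fm Δ)} {H'' : List (Fm Θ)}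
    {u : Sub Γ Δ} {v : Sub Δ Θ} (h : Ext H H' u) (h' : Ext H' H'' v) : Ext H H'' (u.comp v) := by
  intro A hA
  obtain ⟨B, hB, rfl⟩ := List.mem_map.1 hA
  rw [← Fm.subst_subst]
  exact h' (List.mem_map_of_mem (h (List.mem_map_of_mem hB)))

theorem Ext.wk {Γ : Ctx} (H : List (Fm Γ)) (σ : Ty) : Ext H (H.map (Fm.wk σ)) (Sub.wk1 σ) := by
  have : Fm.subst (Sub.wk1 σ) = Fm.wk (Γ := Γ) σ := funext fun A => (Fm.wk_eq σ A).symm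
  rw [Ext, this]
  exact List.Subset.refl _

theorem Ext.weaken {Γ Δ : Ctx} {H : List (Fm Γ)} {H' H'' : List (Fm Δ)} {u : Sub Γ Δ}
    (h : Ext H H' u) (hs : H' ⊆ H'') : Ext H H'' u := List.Subset.trans h hs

theorem Ext.cons {Γ Δ : Ctx} {H : List (Fm Γ)} {H' : List (Fm Δ)} {u : Sub Γ Δ}
    (h : Ext H H' u) (A : Fm Δ) : Ext H (A :: H') u := h.weaken (List.subset_cons_self _ _)

-- Natural deduction rules in Kripke style.

section Rules
variable {Γ : Ctx} {H : List (Fm Γ)}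

theorem imp_intro {A B : Fm Γ} (h : ∀ H' : List (Fm Γ), H ⊆ H' → D H' A → D H' B) :
    D H (A.imp B) := .impI (h _ (List.subset_cons_self _ _) (.hyp List.mem_cons_self))

/-- It suffices to apply the hypothesis at the generic later world, with one fresh variable as the
term. The stronger-looking hypothesis is what lets proofs avoid handling that variable explicitly.
-/
theorem all_intro {σ : Ty} {A : Fm (σ :: Γ)}
    (h : ∀ (Δ : Ctx) (H' : List (Fm Δ)) (u : Sub Γ Δ) (t : Tm Δ σ), Ext H H' u →
      D H' (A.subst (Sub.cons t u))) : D H (.all σ A) := by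
  refine .allI ?_
  simpa using h _ _ _ (.var .vz) (Ext.wk H σ)

theorem all_elim {σ : Ty} {A : Fm (σ :: Γ)} (h : D H (.all σ A)) (t : Tm Γ σ) :
    D H (A.subst (Sub.cons t (Sub.id Γ))) := .allE t h

theorem ex_intro {σ : Ty} {A : Fm (σ :: Γ)} (t : Tm Γ σ)
    (h : D H (A.subst (Sub.cons t (Sub.id Γ)))) : D H (.ex σ A) := .exI t h

theorem ex_elim {σ : Ty} {A : Fm (σ :: Γ)} {C : Fm Γ} (h : D H (.ex σ A))
    (hC : ∀ (Δ : Ctx) (H' : List (Fm Δ)) (u : Sub Γ Δ) (t : Tm Δ σ), Ext H H' u →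
      D H' (A.subst (Sub.cons t u)) → D H' (C.subst u)) : D H C := by
  refine .exE h ?_
  rw [Fm.wk_eq]
  refine hC _ _ _ (.var .vz) ((Ext.wk H σ).cons A) ?_
  simpa using Derives.hyp List.mem_cons_self

theorem or_elim {A B C : Fm Γ} (h : D H (A.or B))
    (hA : ∀ H' : List (Fm Γ), H ⊆ H' → D H' A → D H' C)
    (hB : ∀ H' : List (Fm Γ), H ⊆ H' → D H' B → D H' C) : D H C :=
  .orE h (hA _ (List.subset_cons_self _ _) (.hyp List.mem_cons_self))
    (hB _ (List.subset_cons_self _ _) (.hyp List.mem_cons_self))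

end Rules

/-! Equality and addition. -/

section Arith
variable {Γ : Ctx} {H : List (Fm Γ)}

theorem eq0_symm {s t : Tm Γ .nat} (h : D H (.eq0 s t)) : D H (.eq0 t s) :=
  .impE (.eha (.eq_symm s t)) h

theorem eq0_trans {s t u : Tm Γ .nat} (h : D H (.eq0 s t)) (h' : D H (.eq0 t u)) :
    D H (.eq0 s u) := .impE (.impE (.eha (.eq_trans s t u)) h) h'

theorem eq_app {σ τ : Ty} {f g : Tm Γ (.arr σ τ)} (h : D H (eq (.arr σ τ) f g)) (t : Tm Γ σ) :
    D H (eq τ (.app f t) (.app g t)) := by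
  simpa [eq_subst, Tm.wk_eq, Tm.subst_subst] using (all_elim h t :)

theorem eq0_succ {s t : Tm Γ .nat} (h : D H (.eq0 s t)) :
    D H (.eq0 (.app .succ s) (.app .succ t)) := .impE (.eha (.extensionality .succ s t)) h

theorem add_zero_eq (s : Tm Γ .nat) : D H (.eq0 (s.add .zero) s) := .eha (EHA.R_zero (σ := .nat) _ _)

theorem add_succ_eq (s t : Tm Γ .nat) :
    D H (.eq0 (s.add (.app .succ t)) (.app .succ (s.add t))) := by
  -- The recursion step is `S (K K) succ m t = K K m (succ m) t = K (succ m) t = succ m`, with `m`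
  -- the sum `s + t`.
  refine eq0_trans (.eha (EHA.R_succ (σ := .nat) _ _ _)) ?_
  refine eq0_trans (eq_app (τ := .nat) (.eha (.S_eq _ _ _)) t) ?_
  refine eq0_trans (eq_app (τ := .nat) (eq_app (.eha (.K_eq _ _)) _) t) ?_
  exact .eha (EHA.K_eq (σ := .nat) _ _)

theorem nat_induction {A : Fm (.nat :: Γ)} (hA : A.Internal)
    (h0 : D H (A.subst (Sub.cons .zero (Sub.id Γ))))
    (hs : ∀ (Δ : Ctx) (H' : List (Fm Δ)) (u : Sub Γ Δ) (n : Tm Δ .nat), Ext H H' u →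
      D H' (A.subst (Sub.cons n u)) → D H' (A.subst (Sub.cons (.app .succ n) u)))
    (t : Tm Γ .nat) : D H (A.subst (Sub.cons t (Sub.id Γ))) := by
  refine all_elim (.impE (.impE (.eha (.induction A hA)) h0) ?_) t
  refine all_intro fun Δ H' u n e => ?_
  refine imp_intro fun H'' hs' hn => ?_
  have := hs Δ H'' u n (e.weaken hs') hn
  simpa [Fm.step, Fm.subst_subst, Sub.rename_eq, Sub.ofRen_wk] using this

theorem le0_intro {s t : Tm Γ .nat} (z : Tm Γ .nat) (h : D H (.eq0 (s.add z) t)) :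
    D H (le0 s t) := by
  refine ex_intro z ?_
  simpa [Fm.subst, Tm.add_subst, Tm.wk_eq, Tm.subst_subst] using h

theorem le0_elim {s t : Tm Γ .nat} {C : Fm Γ} (h : D H (le0 s t))
    (hC : ∀ (Δ : Ctx) (H' : List (Fm Δ)) (u : Sub Γ Δ) (z : Tm Δ .nat), Ext H H' u →
      D H' (.eq0 ((s.subst u).add z) (t.subst u)) → D H' (C.subst u)) : D H C := by
  refine ex_elim h fun Δ H' u z e hz => hC Δ H' u z e ?_
  simpa [Fm.subst, Tm.add_subst, Tm.wk_eq, Tm.subst_subst] using hz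

/-- Induction on `w`: if `s + z = t + n`, then `s + (z + 1) = t + (n + 1)`. With it, transitivity of
`≤` needs no associativity or commutativity of addition. -/
theorem le0_add {s t : Tm Γ .nat} (h : D H (le0 s t)) (w : Tm Γ .nat) :
    D H (le0 s (t.add w)) := by
  have := nat_induction (H := H) (A := le0 (s.wk .nat) ((t.wk .nat).add (.var .vz))) trivial
    (by
      simp only [le0_subst, Tm.add_subst, Tm.wk_eq, Tm.subst_subst, Sub.wk1_comp_cons,
        Tm.subst_id, Tm.var_vz_subst_cons]
      refine le0_elim h fun Δ H' u z _ hz => ?_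
      rw [le0_subst]
      exact le0_intro z (eq0_trans hz (eq0_symm (add_zero_eq _))))
    (by
      intro Δ H' u n _ hn
      simp only [le0_subst, Tm.add_subst, Tm.wk_eq, Tm.subst_subst, Sub.wk1_comp_cons,
        Tm.var_vz_subst_cons] at hn ⊢
      refine le0_elim hn fun Δ H' u z _ hz => ?_
      rw [le0_subst]
      exact le0_intro (.app .succ z)
        (eq0_trans (add_succ_eq _ _) (eq0_trans (eq0_succ hz) (eq0_symm (add_succ_eq _ _)))))
    w
  simpa [le0_subst, Tm.add_subst, Tm.wk_eq, Tm.subst_subst] using this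

theorem le0_refl (s : Tm Γ .nat) : D H (le0 s s) := le0_intro .zero (add_zero_eq s)

theorem le0_trans {s t v : Tm Γ .nat} (h : D H (le0 s t)) (h' : D H (le0 t v)) :
    D H (le0 s v) := by
  refine le0_elim h' fun Δ H' u w e hw => ?_
  have h₁ := h.mono e
  rw [le0_subst] at h₁ ⊢
  refine le0_elim (le0_add h₁ w) fun Δ' H'' u' z e' hz => ?_
  rw [le0_subst]
  exact le0_intro z (eq0_trans hz (hw.mono e'))

/-- Decidability of being zero. -/
theorem zero_or_ne (n : Tm Γ .nat) :
    D H (.or (.eq0 n .zero) (.imp (.eq0 n .zero) .bot)) := by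
  refine nat_induction (A := .or (.eq0 (.var .vz) .zero) (.imp (.eq0 (.var .vz) .zero) .bot))
    (by simp [Fm.Internal]) (.orI₁ (.eha (.eq_refl _))) ?_ n
  intro Δ H' u n _ _
  exact .orI₂ (.eha (.succ_ne_zero _))

end Arith

/-! Majorizability. -/

section Maj
variable {Γ : Ctx} {H : List (Fm Γ)}

theorem maj_app {σ τ : Ty} {f g : Tm Γ (.arr σ τ)} {u v : Tm Γ σ}
    (h : D H (maj _ f g)) (h' : D H (maj σ u v)) : D H (maj τ (.app f u) (.app g v)) := by
  refine Derives.andE₁ (Derives.impE (B := .and _ (maj τ (.app g u) (.app g v))) ?_ h')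
  simpa [Fm.subst, maj_subst, Tm.wk_eq, Tm.subst_subst, Sub.lift_eq, Sub.comp_assoc]
    using all_elim (all_elim h v) u

/-- At function types this is the second conjunct in the definition of `≤*`, used twice. Since `≤*`
is not reflexive, this is the source of monotone elements. -/
theorem maj_right {σ : Ty} {s t : Tm Γ σ} (h : D H (maj σ s t)) : D H (mon t) := by
  cases σ with
  | nat => exact le0_refl _
  | arr σ τ =>
    refine all_intro fun Δ H' u v e => all_intro fun Δ' H'' u' w e' => ?_
    refine imp_intro fun H₃ hs h' => ?_
    have := all_elim (all_elim (h.mono (e.trans (e'.weaken hs))) (v.subst u')) w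
    simp [Fm.subst, maj_subst, Tm.wk_eq, Tm.subst_subst, Sub.lift_eq,
      Sub.comp_assoc] at h' this ⊢
    exact .andI (.andE₂ (.impE this h')) (.andE₂ (.impE this h'))

theorem maj_intro {σ τ : Ty} {f g : Tm Γ (.arr σ τ)}
    (h : ∀ (Δ : Ctx) (H' : List (Fm Δ)) (s : Sub Γ Δ) (u v : Tm Δ σ), Ext H H' s →
      D H' (maj σ u v) → D H' (.and (maj τ (.app (f.subst s) u) (.app (g.subst s) v))
        (maj τ (.app (g.subst s) u) (.app (g.subst s) v)))) : D H (maj _ f g) := by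
  refine all_intro fun Δ H' u v e => all_intro fun Δ' H'' u' w e' => ?_
  refine imp_intro fun H₃ hs h' => ?_
  have := h Δ' H₃ (u.comp u') w (v.subst u') (e.trans (e'.weaken hs))
  simp [Fm.subst, maj_subst, Tm.wk_eq, Tm.subst_subst, Sub.lift_eq,
    Sub.comp_assoc] at h' this ⊢
  exact this h'

theorem maj_trans {σ : Ty} {s t v : Tm Γ σ} (h : D H (maj σ s t)) (h' : D H (maj σ t v)) :
    D H (maj σ s v) := by
  induction σ generalizing Γ with
  | nat => exact le0_trans h h'
  | arr σ τ _ ih =>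
    refine maj_intro fun Δ H' u w x e hwx => ?_
    have h₁ := h.mono e
    have h₂ := h'.mono e
    rw [maj_subst] at h₁ h₂
    -- For `w ≤* x` the chain is `s w ≤* t x ≤* v x`; its second link needs `x ≤* x`, which holds
    -- because `x` is a majorant.
    exact .andI (ih (maj_app h₁ hwx) (maj_app h₂ (maj_right hwx))) (maj_app (maj_right h₂) hwx)

end Maj

/-! Tuples of standard, monotone and majorized terms. -/

theorem maj_of_subst {Γ Δ : Ctx} {H : List (Fm Δ)} {σ : Ty} {t u : Tm Γ σ} {s : Sub Γ Δ}
    (h : D H ((maj σ t u).subst s)) : D H (maj σ (t.subst s) (u.subst s)) := by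
  rwa [maj_subst] at h

/-- The pointwise extension of a relation to tuples. -/
def Tms.Rel {Γ : Ctx} (P : ∀ σ, Tm Γ σ → Tm Γ σ → Prop) :
    {σs : List Ty} → Tms Γ σs → Tms Γ σs → Prop
  | [], _, _ => True
  | σ :: _, t, u => P σ t.1 u.1 ∧ Tms.Rel P t.2 u.2

def MajT {Γ : Ctx} (H : List (Fm Γ)) {σs : List Ty} (t u : Tms Γ σs) : Prop :=
  Tms.Rel (fun σ t u => D H (maj σ t u)) t u

/-- A unary property cast as a relation that ignores its second argument, so that it shares the
splitting and concatenation lemmas of `Tms.Rel` with `MajT`. -/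
def StT {Γ : Ctx} (H : List (Fm Γ)) {σs : List Ty} (t : Tms Γ σs) : Prop :=
  Tms.Rel (fun _ t _ => D H (.st t)) t t

structure StMon {Γ : Ctx} (H : List (Fm Γ)) {σs : List Ty} (t : Tms Γ σs) : Prop where
  st : StT H t
  mon : MajT H t t

section Rel
variable {Γ : Ctx} {P : ∀ σ, Tm Γ σ → Tm Γ σ → Prop} {σs τs : List Ty}

theorem Tms.Rel.left {t u : Tms Γ (σs ++ τs)} (h : Tms.Rel P t u) :
    Tms.Rel P (Tms.left σs t) (Tms.left σs u) := by
  induction σs with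
  | nil => trivial
  | cons σ σs ih => exact ⟨h.1, ih h.2⟩

theorem Tms.Rel.right {t u : Tms Γ (σs ++ τs)} (h : Tms.Rel P t u) :
    Tms.Rel P (Tms.right σs t) (Tms.right σs u) := by
  induction σs with
  | nil => exact h
  | cons σ σs ih => exact ih h.2

theorem Tms.Rel.append {t t' : Tms Γ σs} {u u' : Tms Γ τs} (h : Tms.Rel P t t')
    (h' : Tms.Rel P u u') : Tms.Rel P (t.append u) (t'.append u') := by
  induction σs with
  | nil => exact h'
  | cons σ σs ih => exact ⟨h.1, ih h.2⟩

end Rel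

section Tuples
variable {Γ Δ : Ctx} {H : List (Fm Γ)} {H' : List (Fm Δ)} {s : Sub Γ Δ} {σs τs : List Ty}

theorem MajT.mono {t u : Tms Γ σs} (h : MajT H t u) (e : Ext H H' s) :
    MajT H' (t.subst s) (u.subst s) := by
  induction σs with
  | nil => trivial
  | cons σ σs ih => exact ⟨maj_of_subst (h.1.mono e), ih h.2⟩

theorem MajT.trans {t u v : Tms Γ σs} (h : MajT H t u) (h' : MajT H u v) : MajT H t v := by
  induction σs with
  | nil => trivial
  | cons σ σs ih => exact ⟨maj_trans h.1 h'.1, ih h.2 h'.2⟩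

theorem maj_apps {τ : Ty} {f g : Tm Γ (arrs σs τ)} {t u : Tms Γ σs} (h : D H (maj _ f g))
    (h' : MajT H t u) : D H (maj τ (Tm.apps σs f t) (Tm.apps σs g u)) := by
  induction σs with
  | nil => exact h
  | cons σ σs ih => exact ih (maj_app h h'.1) h'.2

theorem MajT.apps {f g : Tms Γ (τs.map (arrs σs))} {t u : Tms Γ σs} (h : MajT H f g)
    (h' : MajT H t u) : MajT H (Tms.apps σs τs f t) (Tms.apps σs τs g u) := by
  induction τs with
  | nil => trivial
  | cons τ τs ih => exact ⟨maj_apps h.1 h', ih h.2⟩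

theorem MajT.left {t u : Tms Γ (σs ++ τs)} (h : MajT H t u) :
    MajT H (Tms.left σs t) (Tms.left σs u) := Tms.Rel.left h

theorem MajT.right {t u : Tms Γ (σs ++ τs)} (h : MajT H t u) :
    MajT H (Tms.right σs t) (Tms.right σs u) := Tms.Rel.right h

theorem StT.mono {t : Tms Γ σs} (h : StT H t) (e : Ext H H' s) : StT H' (t.subst s) := by
  induction σs with
  | nil => trivial
  | cons σ σs ih => exact ⟨h.1.mono e, ih h.2⟩

theorem StT.of_maj {t u : Tms Γ σs} (h : StT H u) (h' : MajT H t u) : StT H t := by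
  induction σs with
  | nil => trivial
  | cons σ σs ih => exact ⟨.impE (.impE (.stAx (.maj _ _)) h.1) h'.1, ih h.2 h'.2⟩

theorem st_apps {τ : Ty} {f : Tm Γ (arrs σs τ)} {t : Tms Γ σs} (h : D H (.st f))
    (h' : StT H t) : D H (.st (Tm.apps σs f t)) := by
  induction σs with
  | nil => exact h
  | cons σ σs ih => exact ih (.impE (.impE (.stAx (.app _ _)) h) h'.1) h'.2

theorem StT.apps {f : Tms Γ (τs.map (arrs σs))} {t : Tms Γ σs} (h : StT H f)
    (h' : StT H t) : StT H (Tms.apps σs τs f t) := by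
  induction τs with
  | nil => trivial
  | cons τ τs ih => exact ⟨st_apps h.1 h', ih h.2⟩

theorem StMon.mono {t : Tms Γ σs} (h : StMon H t) (e : Ext H H' s) : StMon H' (t.subst s) :=
  ⟨h.1.mono e, h.2.mono e⟩

/-- Standardness passes down along `≤*` by the second standardness axiom, so bounded monotone
quantifiers below a standard tuple range over standard elements. -/
theorem StMon.of_maj {t u : Tms Γ σs} (h : StMon H u) (ht : MajT H t t) (h' : MajT H t u) :
    StMon H t := ⟨h.1.of_maj h', ht⟩

theorem StMon.apps {f : Tms Γ (τs.map (arrs σs))} {t : Tms Γ σs} (h : StMon H f)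
    (h' : StMon H t) : StMon H (Tms.apps σs τs f t) := ⟨h.1.apps h'.1, h.2.apps h'.2⟩

theorem StMon.left {t : Tms Γ (σs ++ τs)} (h : StMon H t) : StMon H (Tms.left σs t) :=
  ⟨Tms.Rel.left h.1, Tms.Rel.left h.2⟩

theorem StMon.right {t : Tms Γ (σs ++ τs)} (h : StMon H t) : StMon H (Tms.right σs t) :=
  ⟨Tms.Rel.right h.1, Tms.Rel.right h.2⟩

theorem StMon.append {t : Tms Γ σs} {u : Tms Γ τs} (h : StMon H t) (h' : StMon H u) :
    StMon H (t.append u) := ⟨Tms.Rel.append h.1 h'.1, Tms.Rel.append h.2 h'.2⟩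

theorem MajT.weaken {H'' : List (Fm Γ)} {t u : Tms Γ σs} (h : MajT H t u) (e : H ⊆ H'') :
    MajT H'' t u := by simpa using h.mono (.of_subset e)

theorem StMon.weaken {H'' : List (Fm Γ)} {t : Tms Γ σs} (h : StMon H t) (e : H ⊆ H'') :
    StMon H'' t := by simpa using h.mono (.of_subset e)

end Tuples

/-! Rules for blocks of quantifiers. -/

section BlockRules
variable {Γ : Ctx} {H : List (Fm Γ)} {σs : List Ty}

theorem allStMon_intro {A : Fm (ext Γ σs)}
    (h : ∀ (Δ : Ctx) (H' : List (Fm Δ)) (u : Sub Γ Δ) (t : Tms Δ σs), Ext H H' u → StMon H' t →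
      D H' (A.subst (Sub.conss t u))) : D H (allStMon σs A) := by
  induction σs generalizing Γ with
  | nil => simpa [Sub.conss, allStMon] using h Γ H (Sub.id Γ) () (.refl H) ⟨trivial, trivial⟩
  | cons σ σs ih =>
    refine .allI (.impI (ih fun Δ H' u t e ht => ?_))
    have hg := Derives.hyp (Ax := fun _ A => CharAx A) (e List.mem_cons_self)
    have := h Δ H' ((Sub.wk1 σ).comp u) ((Tm.var .vz).subst u, t)
      (((Ext.wk H σ).cons _).trans e)
      ⟨⟨.andE₁ hg, ht.1⟩, ⟨maj_of_subst (.andE₂ hg), ht.2⟩⟩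
    -- The image of the fresh variable together with the rest of `u` is `u` itself.
    rwa [Sub.conss, show Sub.cons ((Tm.var .vz).subst u) ((Sub.wk1 σ).comp u) = u from
      Sub.cons_eta u] at this

theorem allStMon_elim {A : Fm (ext Γ σs)} (h : D H (allStMon σs A)) {t : Tms Γ σs}
    (ht : StMon H t) : D H (A.subst (Sub.conss t (Sub.id Γ))) := by
  -- Instantiating the first variable of the block leaves a nontrivial substitution on the remaining
  -- ones, so the induction needs an arbitrary `s` in place of the identity.
  suffices key : ∀ {Γ Δ : Ctx} {H : List (Fm Δ)} (s : Sub Γ Δ) (A : Fm (ext Γ σs))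
      (_ : D H ((allStMon σs A).subst s)) {t : Tms Δ σs} (_ : StMon H t),
      D H (A.subst (Sub.conss t s)) from key (Sub.id Γ) A (by simpa using h) ht
  clear h ht t A
  induction σs with
  | nil => intro _ _ _ s A h t _; exact h
  | cons σ σs ih =>
    intro Γ Δ H s A h t ht
    have h₁ := all_elim h t.1
    rw [Fm.subst_subst] at h₁
    refine ih _ A (.impE (by simpa [Sub.lift_eq, Fm.subst, Sub.comp_assoc] using h₁) ?_)
      ⟨ht.1.2, ht.2.2⟩
    simpa [Fm.subst, mon, maj_subst] using Derives.andI ht.1.1 ht.2.1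

theorem exStMon_intro {A : Fm (ext Γ σs)} {t : Tms Γ σs} (ht : StMon H t)
    (h : D H (A.subst (Sub.conss t (Sub.id Γ)))) : D H (exStMon σs A) := by
  suffices key : ∀ {Γ Δ : Ctx} {H : List (Fm Δ)} (s : Sub Γ Δ) (A : Fm (ext Γ σs))
      {t : Tms Δ σs} (_ : StMon H t) (_ : D H (A.subst (Sub.conss t s))),
      D H ((exStMon σs A).subst s) by simpa using key (Sub.id Γ) A ht h
  clear h ht t A
  induction σs with
  | nil => intro _ _ _ s A t _ h; exact h
  | cons σ σs ih =>
    intro Γ Δ H s A t ht h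
    refine ex_intro t.1 ?_
    rw [Fm.subst_subst]
    refine .andI ?_ ?_
    · simpa [Fm.subst, mon, maj_subst, Sub.lift_eq] using Derives.andI ht.1.1 ht.2.1
    · simpa [Sub.lift_eq, Sub.comp_assoc] using ih _ A ⟨ht.1.2, ht.2.2⟩ h

theorem exStMon_elim {A : Fm (ext Γ σs)} {C : Fm Γ} (h : D H (exStMon σs A))
    (hC : ∀ (Δ : Ctx) (H' : List (Fm Δ)) (u : Sub Γ Δ) (t : Tms Δ σs), Ext H H' u → StMon H' t →
      D H' (A.subst (Sub.conss t u)) → D H' (C.subst u)) : D H C := by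
  induction σs generalizing Γ with
  | nil =>
    simpa using hC Γ H (Sub.id Γ) () (.refl H) ⟨trivial, trivial⟩ (by simpa [Sub.conss, exStMon] using h)
  | cons σ σs ih =>
    refine .exE h ?_
    refine ih (.andE₂ (.hyp List.mem_cons_self)) fun Δ H' u t e ht hA => ?_
    have hg := Derives.andE₁ (Derives.hyp (Ax := fun _ A => CharAx A) (e List.mem_cons_self))
    have := hC Δ H' ((Sub.wk1 σ).comp u) ((Tm.var .vz).subst u, t)
      (((Ext.wk H σ).cons _).trans e)
      ⟨⟨.andE₁ hg, ht.1⟩, ⟨maj_of_subst (.andE₂ hg), ht.2⟩⟩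
    rw [Sub.conss, show Sub.cons ((Tm.var .vz).subst u) ((Sub.wk1 σ).comp u) = u from
      Sub.cons_eta u] at this
    rw [Fm.wk_eq, Fm.subst_subst]
    exact this hA

theorem allLeMon_intro {A : Fm (ext Γ σs)} {t : Tms Γ σs}
    (h : ∀ (Δ : Ctx) (H' : List (Fm Δ)) (u : Sub Γ Δ) (v : Tms Δ σs), Ext H H' u → MajT H' v v →
      MajT H' v (t.subst u) → D H' (A.subst (Sub.conss v u))) : D H (allLeMon σs t A) := by
  induction σs generalizing Γ with
  | nil => simpa [Sub.conss, allLeMon] using h Γ H (Sub.id Γ) () (.refl H) trivial trivial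
  | cons σ σs ih =>
    refine .allI (.impI (ih fun Δ H' u v e hv hv' => ?_))
    have hg := Derives.hyp (Ax := fun _ A => CharAx A) (e List.mem_cons_self)
    simp only [Fm.subst, mon_subst, maj_subst, Tm.wk_eq, Tm.subst_subst] at hg
    rw [Tms.rename_eq, Tms.subst_subst] at hv'
    have := h Δ H' ((Sub.wk1 σ).comp u) ((Tm.var .vz).subst u, v)
      (((Ext.wk H σ).cons _).trans e) ⟨.andE₁ hg, hv⟩ ⟨.andE₂ hg, hv'⟩
    rwa [Sub.conss, show Sub.cons ((Tm.var .vz).subst u) ((Sub.wk1 σ).comp u) = u from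
      Sub.cons_eta u] at this

theorem allLeMon_elim {A : Fm (ext Γ σs)} {t : Tms Γ σs} (h : D H (allLeMon σs t A))
    {v : Tms Γ σs} (hv : MajT H v v) (hv' : MajT H v t) :
    D H (A.subst (Sub.conss v (Sub.id Γ))) := by
  suffices key : ∀ {Γ Δ : Ctx} {H : List (Fm Δ)} (s : Sub Γ Δ) (A : Fm (ext Γ σs)) {t : Tms Γ σs}
      (_ : D H ((allLeMon σs t A).subst s)) {v : Tms Δ σs} (_ : MajT H v v)
      (_ : MajT H v (t.subst s)), D H (A.subst (Sub.conss v s)) from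
    key (Sub.id Γ) A (by simpa using h) hv (by simpa using hv')
  clear h hv hv' v t A
  induction σs with
  | nil => intro _ _ _ s A t h v _ _; exact h
  | cons σ σs ih =>
    intro Γ Δ H s A t h v hv hv'
    have h₁ := all_elim h v.1
    rw [Fm.subst_subst] at h₁
    refine ih _ A (.impE (by simpa [Sub.lift_eq, Fm.subst, Sub.comp_assoc] using h₁) ?_) hv.2 ?_
    · simpa [Fm.subst, mon, maj_subst, Tm.wk_eq, Tm.subst_subst, Tms.subst] using
        Derives.andI hv.1 hv'.1
    · rw [Tms.rename_eq, Tms.subst_subst]; exact hv'.2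

theorem exLeMon_elim {A : Fm (ext Γ σs)} {t : Tms Γ σs} {C : Fm Γ} (h : D H (exLeMon σs t A))
    (hC : ∀ (Δ : Ctx) (H' : List (Fm Δ)) (u : Sub Γ Δ) (v : Tms Δ σs), Ext H H' u →
      MajT H' v v → MajT H' v (t.subst u) → D H' (A.subst (Sub.conss v u)) → D H' (C.subst u)) :
    D H C := by
  induction σs generalizing Γ with
  | nil =>
    simpa using hC Γ H (Sub.id Γ) () (.refl H) trivial trivial (by simpa [Sub.conss, exLeMon] using h)
  | cons σ σs ih =>
    refine .exE h ?_
    refine ih (.andE₂ (.hyp List.mem_cons_self)) fun Δ H' u v e hv hv' hA => ?_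
    have hg := Derives.andE₁ (Derives.hyp (Ax := fun _ A => CharAx A) (e List.mem_cons_self))
    simp only [Fm.subst, mon_subst, maj_subst, Tm.wk_eq, Tm.subst_subst] at hg
    rw [Tms.rename_eq, Tms.subst_subst] at hv'
    have := hC Δ H' ((Sub.wk1 σ).comp u) ((Tm.var .vz).subst u, v)
      (((Ext.wk H σ).cons _).trans e) ⟨.andE₁ hg, hv⟩ ⟨.andE₂ hg, hv'⟩
    rw [Sub.conss, show Sub.cons ((Tm.var .vz).subst u) ((Sub.wk1 σ).comp u) = u from
      Sub.cons_eta u] at this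
    rw [Fm.wk_eq, Fm.subst_subst]
    exact this hA

theorem exLe_elim {A : Fm (ext Γ σs)} {t : Tms Γ σs} {C : Fm Γ} (h : D H (exLe σs t A))
    (hC : ∀ (Δ : Ctx) (H' : List (Fm Δ)) (u : Sub Γ Δ) (v : Tms Δ σs), Ext H H' u →
      MajT H' v (t.subst u) → D H' (A.subst (Sub.conss v u)) → D H' (C.subst u)) :
    D H C := by
  induction σs generalizing Γ with
  | nil =>
    simpa using hC Γ H (Sub.id Γ) () (.refl H) trivial (by simpa [Sub.conss, exLe] using h)
  | cons σ σs ih =>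
    refine .exE h ?_
    refine ih (.andE₂ (.hyp List.mem_cons_self)) fun Δ H' u v e hv' hA => ?_
    have hg := Derives.andE₁ (Derives.hyp (Ax := fun _ A => CharAx A) (e List.mem_cons_self))
    simp only [maj_subst, Tm.wk_eq, Tm.subst_subst] at hg
    rw [Tms.rename_eq, Tms.subst_subst] at hv'
    have := hC Δ H' ((Sub.wk1 σ).comp u) ((Tm.var .vz).subst u, v)
      (((Ext.wk H σ).cons _).trans e) ⟨hg, hv'⟩
    rw [Sub.conss, show Sub.cons ((Tm.var .vz).subst u) ((Sub.wk1 σ).comp u) = u from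
      Sub.cons_eta u] at this
    rw [Fm.wk_eq, Fm.subst_subst]
    exact this hA

theorem allLe_intro {A : Fm (ext Γ σs)} {t : Tms Γ σs}
    (h : ∀ (Δ : Ctx) (H' : List (Fm Δ)) (u : Sub Γ Δ) (v : Tms Δ σs), Ext H H' u →
      MajT H' v (t.subst u) → D H' (A.subst (Sub.conss v u))) : D H (allLe σs t A) := by
  induction σs generalizing Γ with
  | nil => simpa [Sub.conss, allLe] using h Γ H (Sub.id Γ) () (.refl H) trivial
  | cons σ σs ih =>
    refine .allI (.impI (ih fun Δ H' u v e hv' => ?_))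
    have hg := Derives.hyp (Ax := fun _ A => CharAx A) (e List.mem_cons_self)
    simp only [maj_subst, Tm.wk_eq, Tm.subst_subst] at hg
    rw [Tms.rename_eq, Tms.subst_subst] at hv'
    have := h Δ H' ((Sub.wk1 σ).comp u) ((Tm.var .vz).subst u, v)
      (((Ext.wk H σ).cons _).trans e) ⟨hg, hv'⟩
    rwa [Sub.conss, show Sub.cons ((Tm.var .vz).subst u) ((Sub.wk1 σ).comp u) = u from
      Sub.cons_eta u] at this

theorem allSt_elim {A : Fm (ext Γ σs)} (h : D H (allSt σs A)) {t : Tms Γ σs}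
    (ht : StT H t) : D H (A.subst (Sub.conss t (Sub.id Γ))) := by
  suffices key : ∀ {Γ Δ : Ctx} {H : List (Fm Δ)} (s : Sub Γ Δ) (A : Fm (ext Γ σs))
      (_ : D H ((allSt σs A).subst s)) {t : Tms Δ σs} (_ : StT H t),
      D H (A.subst (Sub.conss t s)) from key (Sub.id Γ) A (by simpa using h) ht
  clear h ht t A
  induction σs with
  | nil => intro _ _ _ s A h t _; exact h
  | cons σ σs ih =>
    intro Γ Δ H s A h t ht
    have h₁ := all_elim h t.1
    rw [Fm.subst_subst] at h₁
    exact ih _ A (.impE (by simpa [Sub.lift_eq, Fm.subst, Sub.comp_assoc] using h₁) ht.1) ht.2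

theorem exSt_intro {A : Fm (ext Γ σs)} {t : Tms Γ σs} (ht : StT H t)
    (h : D H (A.subst (Sub.conss t (Sub.id Γ)))) : D H (exSt σs A) := by
  suffices key : ∀ {Γ Δ : Ctx} {H : List (Fm Δ)} (s : Sub Γ Δ) (A : Fm (ext Γ σs))
      {t : Tms Δ σs} (_ : StT H t) (_ : D H (A.subst (Sub.conss t s))),
      D H ((exSt σs A).subst s) by simpa using key (Sub.id Γ) A ht h
  clear h ht t A
  induction σs with
  | nil => intro _ _ _ s A t _ h; exact h
  | cons σ σs ih =>
    intro Γ Δ H s A t ht h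
    refine ex_intro t.1 ?_
    rw [Fm.subst_subst]
    refine .andI ht.1 ?_
    simpa [Sub.lift_eq, Sub.comp_assoc] using ih _ A ht.2 h

/-- A closed term of each type. -/
def Tm.default : (σ : Ty) → Tm [] σ
  | .nat => .zero
  | .arr σ τ => .app (.K τ σ) (Tm.default τ)

theorem exists_majorant {σ : Ty} {s : Tm Γ σ} (hs : D H (.st s)) {C : Fm Γ}
    (hC : ∀ (Δ : Ctx) (H' : List (Fm Δ)) (u : Sub Γ Δ) (t : Tm Δ σ), Ext H H' u →
      D H' (.st t) → D H' (maj σ (s.subst u) t) → D H' (C.subst u)) : D H C := by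
  refine ex_elim (.impE (all_elim (.ax (.MAJ σ)) s) hs) fun Δ H' u t e h => ?_
  refine hC Δ H' u t e (.andE₁ h) ?_
  simpa [Fm.subst_subst, Tm.subst_subst, maj_subst, Sub.lift_eq, Sub.comp_assoc] using Derives.andE₂ h

/-- A closed term is standard, so it has a standard majorant, which is monotone by `maj_right`. This
supplies dummy values for components of a prefix that play no role. -/
theorem exists_stMon (σs : List Ty) {C : Fm Γ}
    (hC : ∀ (Δ : Ctx) (H' : List (Fm Δ)) (u : Sub Γ Δ) (t : Tms Δ σs), Ext H H' u →
      StMon H' t → D H' (C.subst u)) : D H C := by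
  induction σs generalizing Γ with
  | nil => simpa using hC Γ H (Sub.id Γ) () (.refl H) ⟨trivial, trivial⟩
  | cons σ σs ih =>
    refine exists_majorant (.stAx (.closed (Tm.default σ))) fun Δ H' u t e ht hm => ?_
    refine ih fun Δ' H'' u' v e' hv => ?_
    have hm' : D H'' (mon (t.subst u')) := maj_of_subst ((maj_right hm).mono e')
    rw [Fm.subst_subst]
    exact hC Δ' H'' (u.comp u') (t.subst u', v) (e.trans e') ⟨⟨ht.mono e', hv.1⟩, ⟨hm', hv.2⟩⟩

end BlockRules

/-! The characteristic principles as rules. -/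

section Principles
attribute [local simp] Fm.subst_subst Tm.subst_subst Tms.subst_subst Sub.comp_assoc Sub.lift_eq
  Sub.lifts_eq Fm.rename_eq Tms.rename_eq Sub.ofRen_lifts Sub.ofRen_wks Tms.wks_eq Fm.wks_eq
  Tms.apps_subst allStMon_subst exStMon_subst allLeMon_subst exLeMon_subst allLe_subst exLe_subst
  allSt_subst exSt_subst

variable {Γ : Ctx} {H : List (Fm Γ)} {σs τs : List Ty} {C : Fm Γ}

/-- The conclusion `∃̃ y ≤* f t, X(t,y)` of the principle is packaged as its elimination rule,
available at every later world and standard monotone `t`. `realization` below has the same shape. -/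
theorem choice {X : Fm (ext (ext Γ σs) τs)} (h : D H (allStMon σs (exStMon τs X)))
    (hC : ∀ (Δ : Ctx) (H' : List (Fm Δ)) (u : Sub Γ Δ) (f : Tms Δ (τs.map (arrs σs))),
      Ext H H' u → StMon H' f →
      (∀ (Θ : Ctx) (H'' : List (Fm Θ)) (v : Sub Δ Θ) (t : Tms Θ σs), Ext H' H'' v → StMon H'' t →
        ∀ B : Fm Θ, (∀ (Ξ : Ctx) (H₃ : List (Fm Ξ)) (w : Sub Θ Ξ) (y : Tms Ξ τs), Ext H'' H₃ w →
          MajT H₃ y ((Tms.apps σs τs (f.subst v) t).subst w) →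
          D H₃ (X.subst (Sub.conss y (Sub.conss (t.subst w) (u.comp (v.comp w))))) →
          D H₃ (B.subst w)) → D H'' B) →
      D H' (C.subst u)) : D H C := by
  refine exStMon_elim (.impE (.ax (.mAC σs τs X)) h) fun Δ H' u f e hf hX => ?_
  refine hC Δ H' u f e hf fun Θ H'' v t e' ht B hB => ?_
  have h₁ := hX.mono e'
  rw [Fm.subst_subst, allStMon_subst] at h₁
  have h₂ := allStMon_elim h₁ ht
  rw [Fm.subst_subst, exLeMon_subst] at h₂
  refine exLeMon_elim h₂ fun Ξ H₃ w y e'' _ hy' hX => ?_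
  refine hB Ξ H₃ w y e'' ?_ ?_
  · simpa using hy'
  · simpa using hX

theorem Realization_single {σ : Ty} (X : Fm (ext (σ :: Γ) τs)) :
    Realization [σ] τs X = .imp (.all σ (exSt τs X))
      (exStMon τs (.all σ (exLe τs ((vars τs).subst (Sub.wk1 σ))
        (X.subst (((Sub.wkT τs).lift σ).lifts τs))))) := by
  rw [← Sub.ofRen_wks τs, Sub.lift_ofRen, ← Sub.ofRen_lifts, ← Fm.rename_eq, Sub.wk1,
    ← Tms.rename_eq]
  rfl

theorem Idealization_single {σ : Ty} (X : Fm (ext (σ :: Γ) τs)) :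
    Idealization [σ] τs X = .imp
      (allStMon τs (.ex σ (allLe τs ((vars τs).subst (Sub.wk1 σ))
        (X.subst (((Sub.wkT τs).lift σ).lifts τs))))) (.ex σ (allSt τs X)) := by
  rw [← Sub.ofRen_wks τs, Sub.lift_ofRen, ← Sub.ofRen_lifts, ← Fm.rename_eq, Sub.wk1,
    ← Tms.rename_eq]
  rfl

theorem realization {σ : Ty} {X : Fm (ext (σ :: Γ) τs)} (h : D H (.all σ (exSt τs X)))
    (hC : ∀ (Δ : Ctx) (H' : List (Fm Δ)) (u : Sub Γ Δ) (z : Tms Δ τs),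
      Ext H H' u → StMon H' z →
      (∀ (Θ : Ctx) (H'' : List (Fm Θ)) (v : Sub Δ Θ) (t : Tm Θ σ), Ext H' H'' v →
        ∀ B : Fm Θ, (∀ (Ξ : Ctx) (H₃ : List (Fm Ξ)) (w : Sub Θ Ξ) (y : Tms Ξ τs), Ext H'' H₃ w →
          MajT H₃ y ((z.subst v).subst w) →
          D H₃ (X.subst (Sub.conss y (Sub.cons (t.subst w) (u.comp (v.comp w))))) →
          D H₃ (B.subst w)) → D H'' B) →
      D H' (C.subst u)) : D H C := by
  have ax : D H (Realization [σ] τs X) := .ax (.R [σ] τs X)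
  rw [Realization_single] at ax
  refine exStMon_elim (.impE ax h) fun Δ H' u z e hz hX => ?_
  refine hC Δ H' u z e hz fun Θ H'' v t e' B hB => ?_
  have h₁ := hX.mono e'
  rw [Fm.subst_subst] at h₁
  have h₂ := all_elim h₁ t
  rw [Fm.subst_subst] at h₂
  rw [exLe_subst] at h₂
  refine exLe_elim h₂ fun Ξ H₃ w y e'' hy' hX => ?_
  refine hB Ξ H₃ w y e'' ?_ ?_
  · simpa using hy'
  · simpa using hX

/-- `∃ x ∀ y ≤* z, X(x,y)`, where the substitution `u` is applied to the remaining variables. -/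
def exAllLe {Δ : Ctx} {σ : Ty} (X : Fm (ext (σ :: Γ) τs)) (u : Sub Γ Δ) (z : Tms Δ τs) : Fm Δ :=
  .ex σ (allLe τs (z.subst (Sub.wk1 σ)) (X.subst ((u.lift σ).lifts τs)))

theorem exAllLe_subst {Δ Θ : Ctx} {σ : Ty} (X : Fm (ext (σ :: Γ) τs)) (u : Sub Γ Δ)
    (z : Tms Δ τs) (v : Sub Δ Θ) :
    (exAllLe X u z).subst v = exAllLe X (u.comp v) (z.subst v) := by
  simp [exAllLe, Fm.subst]

theorem exAllLe_intro {Δ : Ctx} {K : List (Fm Δ)} {σ : Ty} {X : Fm (ext (σ :: Γ) τs)}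
    {u : Sub Γ Δ} {z : Tms Δ τs} (t : Tm Δ σ)
    (h : ∀ (Θ : Ctx) (H' : List (Fm Θ)) (v : Sub Δ Θ) (y : Tms Θ τs), Ext K H' v →
      MajT H' y (z.subst v) →
      D H' (X.subst (Sub.conss y (Sub.cons (t.subst v) (u.comp v))))) : D K (exAllLe X u z) := by
  refine ex_intro t ?_
  rw [allLe_subst]
  refine allLe_intro fun Θ H' v y e hy => ?_
  simpa using h Θ H' v y e (by simpa using hy)

theorem idealization {σ : Ty} {X : Fm (ext (σ :: Γ) τs)} (hX : X.Internal)
    (h : ∀ (Δ : Ctx) (H' : List (Fm Δ)) (u : Sub Γ Δ) (z : Tms Δ τs), Ext H H' u → StMon H' z →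
      D H' (exAllLe X u z))
    (hC : ∀ (Δ : Ctx) (H' : List (Fm Δ)) (u : Sub Γ Δ) (t : Tm Δ σ), Ext H H' u →
      (∀ (Θ : Ctx) (H'' : List (Fm Θ)) (v : Sub Δ Θ) (y : Tms Θ τs), Ext H' H'' v → StT H'' y →
        D H'' (X.subst (Sub.conss y (Sub.cons (t.subst v) (u.comp v))))) →
      D H' (C.subst u)) : D H C := by
  have ax : D H (Idealization [σ] τs X) := .ax (.I [σ] τs X hX)
  rw [Idealization_single] at ax
  refine ex_elim (.impE ax ?_) fun Δ H' u t e ht => ?_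
  · refine allStMon_intro fun Δ H' u z e hz => ?_
    convert h Δ H' u z e hz using 1
    simp [exAllLe, Fm.subst]
  · refine hC Δ H' u t e fun Θ H'' v y e' hy => ?_
    have h₁ := ht.mono e'
    rw [Fm.subst_subst, allSt_subst] at h₁
    simpa using allSt_elim h₁ hy

theorem independence {A : Fm (ext Γ σs)} (hA : A.Internal) {B : Fm (ext Γ τs)}
    (h : D H (.imp (allStMon σs A) (exStMon τs B)))
    (hC : ∀ (Δ : Ctx) (H' : List (Fm Δ)) (u : Sub Γ Δ) (y : Tms Δ τs), Ext H H' u → StMon H' y →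
      D H' (.imp ((allStMon σs A).subst u) (exLeMon τs y (B.subst (u.lifts τs)))) →
      D H' (C.subst u)) : D H C := by
  refine exStMon_elim (.impE (.ax (.IP σs τs A hA B)) h) fun Δ H' u y e hy hX => ?_
  refine hC Δ H' u y e hy ?_
  simpa [Fm.subst] using hX

theorem markov {A : Fm (ext Γ σs)} (hA : A.Internal) {B : Fm Γ} (hB : B.Internal)
    (h : D H (.imp (allStMon σs A) B))
    (hC : ∀ (Δ : Ctx) (H' : List (Fm Δ)) (u : Sub Γ Δ) (y : Tms Δ σs), Ext H H' u → StMon H' y →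
      D H' (.imp (allLeMon σs y (A.subst (u.lifts σs))) (B.subst u)) →
      D H' (C.subst u)) : D H C := by
  refine exStMon_elim (.impE (.ax (.MP σs A hA B hB)) h) fun Δ H' u y e hy hX => ?_
  refine hC Δ H' u y e hy ?_
  simpa [Fm.subst] using hX

end Principles

/-! Internality. -/

theorem maj_internal {Γ : Ctx} {σ : Ty} (s t : Tm Γ σ) : (maj σ s t).Internal := by
  induction σ generalizing Γ with
  | nat => trivial
  | arr σ τ ih₁ ih₂ => exact ⟨ih₁ _ _, ih₂ _ _, ih₂ _ _⟩

theorem allLeMon_internal {Γ : Ctx} {σs : List Ty} (t : Tms Γ σs) {A : Fm (ext Γ σs)}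
    (hA : A.Internal) : (allLeMon σs t A).Internal := by
  induction σs generalizing Γ with
  | nil => exact hA
  | cons σ σs ih => exact ⟨⟨maj_internal _ _, maj_internal _ _⟩, ih _ hA⟩

theorem Fm.inner_internal {Γ Δ : Ctx} (A : Fm Γ) (s : Sub Γ Δ) (b : Tms Δ A.wit)
    (c : Tms Δ A.chal) : (A.inner s b c).Internal := by
  induction A generalizing Δ with
  | eq0 t u => trivial
  | st t => exact maj_internal _ _
  | bot => trivial
  | and A B ihA ihB => exact ⟨ihA _ _ _, ihB _ _ _⟩
  | or A B ihA ihB =>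
    exact ⟨allLeMon_internal _ (ihA _ _ _), allLeMon_internal _ (ihB _ _ _)⟩
  | imp A B ihA ihB => exact ⟨allLeMon_internal _ (ihA _ _ _), ihB _ _ _⟩
  | all σ A ih => exact ih _ _ _
  | ex σ A ih => exact allLeMon_internal (Γ := σ :: Δ) _ (ih _ _ _)

/-! The parts of the interpretation. -/

section Interp
attribute [local simp] Fm.subst_subst Tm.subst_subst Tms.subst_subst Sub.comp_assoc Sub.lift_eq
  Sub.lifts_eq Fm.inner_subst allStMon_subst exStMon_subst allLeMon_subst

variable {Γ Δ Θ : Ctx}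

/-- `∀̃ c' ≤* c, A_I(b,c')`. -/
def Fm.innerLe (A : Fm Γ) (s : Sub Γ Δ) (b : Tms Δ A.wit) (c : Tms Δ A.chal) : Fm Δ :=
  allLeMon A.chal c (A.inner (s.comp (Sub.wkT A.chal)) (b.subst (Sub.wkT A.chal)) (vars A.chal))

/-- `∀̃ˢᵗ c, A_I(b,c)`. -/
def Fm.innerAll (A : Fm Γ) (s : Sub Γ Δ) (b : Tms Δ A.wit) : Fm Δ :=
  allStMon A.chal (A.inner (s.comp (Sub.wkT A.chal)) (b.subst (Sub.wkT A.chal)) (vars A.chal))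

/-- The interpretation of `A`, where `s` is applied to the free variables. -/
def Fm.int (A : Fm Γ) (s : Sub Γ Δ) : Fm Δ :=
  exStMon A.wit (A.innerAll (s.comp (Sub.wkT A.wit)) (vars A.wit))

theorem Fm.interp_eq (A : Fm Γ) : A.interp = A.int (Sub.id Γ) := by
  simp [Fm.interp, Fm.int, Fm.innerAll, Sub.wks_eq, Tms.wks_eq]

theorem Fm.innerLe_subst (A : Fm Γ) (s : Sub Γ Δ) (b : Tms Δ A.wit) (c : Tms Δ A.chal)
    (u : Sub Δ Θ) : (A.innerLe s b c).subst u = A.innerLe (s.comp u) (b.subst u) (c.subst u) := by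
  simp [Fm.innerLe]

theorem Fm.innerAll_subst (A : Fm Γ) (s : Sub Γ Δ) (b : Tms Δ A.wit) (u : Sub Δ Θ) :
    (A.innerAll s b).subst u = A.innerAll (s.comp u) (b.subst u) := by
  simp [Fm.innerAll]

theorem Fm.int_subst (A : Fm Γ) (s : Sub Γ Δ) (u : Sub Δ Θ) :
    (A.int s).subst u = A.int (s.comp u) := by
  simp [Fm.int, Fm.innerAll_subst]

theorem Fm.innerLe_internal (A : Fm Γ) (s : Sub Γ Δ) (b : Tms Δ A.wit) (c : Tms Δ A.chal) :
    (A.innerLe s b c).Internal := allLeMon_internal _ (A.inner_internal _ _ _)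

variable {H : List (Fm Δ)} {A B : Fm Γ} {s : Sub Γ Δ}

theorem innerLe_intro {b : Tms Δ A.wit} {c : Tms Δ A.chal}
    (h : ∀ (Θ : Ctx) (H' : List (Fm Θ)) (u : Sub Δ Θ) (v : Tms Θ A.chal), Ext H H' u →
      MajT H' v v → MajT H' v (c.subst u) → D H' (A.inner (s.comp u) (b.subst u) v)) :
    D H (A.innerLe s b c) := by
  refine allLeMon_intro fun Θ H' u v e hv hv' => ?_
  simpa using h Θ H' u v e hv hv'

theorem innerLe_elim {b : Tms Δ A.wit} {c v : Tms Δ A.chal} (h : D H (A.innerLe s b c))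
    (hv : MajT H v v) (hv' : MajT H v c) : D H (A.inner s b v) := by
  simpa using allLeMon_elim h hv hv'

theorem innerAll_intro {b : Tms Δ A.wit}
    (h : ∀ (Θ : Ctx) (H' : List (Fm Θ)) (u : Sub Δ Θ) (c : Tms Θ A.chal), Ext H H' u →
      StMon H' c → D H' (A.inner (s.comp u) (b.subst u) c)) :
    D H (A.innerAll s b) := by
  refine allStMon_intro fun Θ H' u c e hc => ?_
  simpa using h Θ H' u c e hc

theorem innerAll_elim {b : Tms Δ A.wit} {c : Tms Δ A.chal} (h : D H (A.innerAll s b))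
    (hc : StMon H c) : D H (A.inner s b c) := by
  simpa using allStMon_elim h hc

/-- Monotone elements below a standard `c` are again standard, hence lie in the range of the
unbounded quantifier. -/
theorem innerAll_le {b : Tms Δ A.wit} {c : Tms Δ A.chal} (h : D H (A.innerAll s b))
    (hc : StMon H c) : D H (A.innerLe s b c) := by
  refine innerLe_intro fun Θ H' u v e hv hv' => ?_
  have h' := h.mono e
  rw [Fm.innerAll_subst] at h'
  exact innerAll_elim h' ((hc.mono e).of_maj hv hv')

theorem int_intro {b : Tms Δ A.wit} (hb : StMon H b) (h : D H (A.innerAll s b)) :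
    D H (A.int s) := by
  refine exStMon_intro hb ?_
  simpa [Fm.innerAll_subst] using h

theorem int_elim {C : Fm Δ} (h : D H (A.int s))
    (hC : ∀ (Θ : Ctx) (H' : List (Fm Θ)) (u : Sub Δ Θ) (b : Tms Θ A.wit), Ext H H' u →
      StMon H' b → D H' (A.innerAll (s.comp u) b) → D H' (C.subst u)) : D H C := by
  refine exStMon_elim h fun Θ H' u b e hb hA => hC Θ H' u b e hb ?_
  simpa [Fm.innerAll_subst] using hA

theorem innerLe_anti {b : Tms Δ A.wit} {c c' : Tms Δ A.chal} (h : D H (A.innerLe s b c))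
    (hc : MajT H c' c) : D H (A.innerLe s b c') := by
  refine innerLe_intro fun Θ H' u v e hv hv' => ?_
  have h' := h.mono e
  rw [Fm.innerLe_subst] at h'
  exact innerLe_elim h' hv (hv'.trans (hc.mono e))

theorem inner_all_elim {σ : Ty} {A : Fm (σ :: Γ)} {b : Tms Δ A.wit} {c : Tms Δ A.chal}
    (h : D H ((Fm.all σ A).inner s b c)) (t : Tm Δ σ) : D H (A.inner (Sub.cons t s) b c) := by
  rw [Fm.inner_all] at h
  simpa using all_elim h t

theorem inner_all_intro {σ : Ty} {A : Fm (σ :: Γ)} {b : Tms Δ A.wit} {c : Tms Δ A.chal}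
    (h : ∀ (Θ : Ctx) (H' : List (Fm Θ)) (u : Sub Δ Θ) (t : Tm Θ σ), Ext H H' u →
      D H' (A.inner (Sub.cons t (s.comp u)) (b.subst u) (c.subst u))) :
    D H ((Fm.all σ A).inner s b c) := by
  rw [Fm.inner_all]
  refine all_intro fun Θ H' u t e => ?_
  simpa using h Θ H' u t e

theorem inner_ex_intro {σ : Ty} {A : Fm (σ :: Γ)} {b : Tms Δ A.wit} {c : Tms Δ A.chal}
    (t : Tm Δ σ) (h : D H (A.innerLe (Sub.cons t s) b c)) :
    D H ((Fm.ex σ A).inner s b c) := by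
  rw [Fm.inner_ex]
  refine ex_intro t ?_
  simpa [Fm.innerLe] using h

theorem inner_ex_elim {σ : Ty} {A : Fm (σ :: Γ)} {b : Tms Δ A.wit} {c : Tms Δ A.chal} {C : Fm Δ}
    (h : D H ((Fm.ex σ A).inner s b c))
    (hC : ∀ (Θ : Ctx) (H' : List (Fm Θ)) (u : Sub Δ Θ) (t : Tm Θ σ), Ext H H' u →
      D H' (A.innerLe (Sub.cons t (s.comp u)) (b.subst u) (c.subst u)) → D H' (C.subst u)) :
    D H C := by
  rw [Fm.inner_ex] at h
  refine ex_elim h fun Θ H' u t e ht => hC Θ H' u t e ?_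
  simpa [Fm.innerLe] using ht

end Interp

/-- `A_I(b,c)` is monotone in `b`, for monotone `c`. -/
theorem inner_mono {Γ Δ : Ctx} (A : Fm Γ) {H : List (Fm Δ)} {s : Sub Γ Δ} {b b' : Tms Δ A.wit}
    {c : Tms Δ A.chal} (hb : MajT H b b') (hc : MajT H c c) (h : D H (A.inner s b c)) :
    D H (A.inner s b' c) := by
  -- The bounded form inherits monotonicity without assuming anything about `c`, since its
  -- quantifier already ranges over monotone tuples.
  have le : ∀ {Γ Δ : Ctx} (A : Fm Γ)
      (_ : ∀ {Δ : Ctx} {H : List (Fm Δ)} {s : Sub Γ Δ} {b b' : Tms Δ A.wit} {c : Tms Δ A.chal},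
        MajT H b b' → MajT H c c → D H (A.inner s b c) → D H (A.inner s b' c))
      {H : List (Fm Δ)} {s : Sub Γ Δ} {b b' : Tms Δ A.wit} {c : Tms Δ A.chal},
      MajT H b b' → D H (A.innerLe s b c) → D H (A.innerLe s b' c) := by
    intro Γ Δ A ih H s b b' c hb h
    refine innerLe_intro fun Θ H' u v e hv hv' => ?_
    have h' := h.mono e
    rw [Fm.innerLe_subst] at h'
    exact ih (hb.mono e) hv (innerLe_elim h' hv hv')
  induction A generalizing Δ with
  | eq0 t u => exact h
  | st t => exact maj_trans h hb.1
  | bot => exact h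
  | and A B ihA ihB =>
    exact .andI (ihA hb.left hc.left (.andE₁ h)) (ihB hb.right hc.right (.andE₂ h))
  | or A B ihA ihB =>
    rw [Fm.inner_or] at h ⊢
    refine or_elim h (fun H' e h' => .orI₁ ?_) (fun H' e h' => .orI₂ ?_)
    · exact le A ihA (hb.left.weaken e) h'
    · exact le B ihB (hb.right.weaken e) h'
  | imp A B ihA ihB =>
    rw [Fm.inner_imp] at h ⊢
    refine imp_intro fun H' e h' => ?_
    have hfg := (MajT.apps (hb.weaken e) (hc.left.weaken e))
    refine ihB hfg.left (hc.right.weaken e) (.impE (h.weaken e) ?_)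
    -- The new premise is bounded by the larger functional, so it implies the old one: here the
    -- bounded quantifier in the clause for `→` is essential.
    exact innerLe_anti h' (MajT.apps hfg.right (hc.right.weaken e))
  | all σ A ih =>
    refine inner_all_intro fun Θ H' u t e => ?_
    have h' := h.mono e
    rw [Fm.inner_subst] at h'
    exact ih (hb.mono e) (hc.mono e) (inner_all_elim h' t)
  | ex σ A ih =>
    refine inner_ex_elim h fun Θ H' u t e h' => ?_
    rw [Fm.inner_subst]
    exact inner_ex_intro t (le A ih (hb.mono e) h')

theorem innerAll_mono {Γ Δ : Ctx} {A : Fm Γ} {H : List (Fm Δ)} {s : Sub Γ Δ} {b b' : Tms Δ A.wit}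
    (hb : MajT H b b') (h : D H (A.innerAll s b)) : D H (A.innerAll s b') := by
  refine innerAll_intro fun Θ H' u c e hc => ?_
  have h' := h.mono e
  rw [Fm.innerAll_subst] at h'
  exact inner_mono A (hb.mono e) hc.2 (innerAll_elim h' hc)

/-! The characterization of the interpretation, one connective at a time. -/

/-- The interpretation of `A` is provably equivalent to `A`. -/
def Characterized {Γ : Ctx} (A : Fm Γ) : Prop :=
  ∀ (Δ : Ctx) (s : Sub Γ Δ) (H : List (Fm Δ)), D H (A.int s) ↔ D H (A.subst s)

attribute [local simp] Fm.subst_subst Tm.subst_subst Tms.subst_subst Sub.comp_assoc Sub.lift_eq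
  Sub.lifts_eq Fm.inner_subst Fm.innerLe_subst Fm.innerAll_subst Fm.int_subst allStMon_subst
  exStMon_subst allLeMon_subst exLeMon_subst exSt_subst Tms.left_subst Tms.right_subst
  Tms.apps_subst

section
variable {Γ : Ctx} {A B : Fm Γ}

theorem Characterized.of_int_eq (h : ∀ (Δ : Ctx) (s : Sub Γ Δ), A.int s = A.subst s) :
    Characterized A := fun Δ s H => by rw [h Δ s]

theorem Characterized.st {σ : Ty} (t : Tm Γ σ) : Characterized (.st t) := by
  intro Δ s H
  constructor
  · intro h
    refine int_elim h fun Θ H' u b e hb hI => ?_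
    have hI : D H' (maj σ (t.subst (s.comp u)) b.1) :=
      innerAll_elim hI (c := ()) ⟨trivial, trivial⟩
    simpa [Fm.subst] using Derives.impE (.impE (.stAx (.maj _ _)) hb.1.1) hI
  · intro h
    refine exists_majorant h fun Θ H' u b e hb hm => ?_
    rw [Fm.int_subst]
    -- A majorant of a standard element is the witness, and it is monotone by `maj_right`.
    refine int_intro (A := .st t) (b := (b, ())) ⟨⟨hb, trivial⟩, ⟨maj_right hm, trivial⟩⟩ ?_
    refine innerAll_intro fun Ξ H₃ v c e' _ => ?_
    have := hm.mono e'
    rw [maj_subst, Tm.subst_subst, Tm.subst_subst, ← Sub.comp_assoc] at this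
    exact this

theorem Characterized.and (hA : Characterized A) (hB : Characterized B) :
    Characterized (A.and B) := by
  intro Δ s H
  constructor
  · intro h
    refine int_elim h fun Θ H' u b e hb hI => ?_
    -- The two challenges are quantified jointly; to isolate one conjunct, the other challenge is
    -- filled with a dummy value.
    refine exists_stMon (A.chal ++ B.chal) fun Θ' H'' u' c e' hc => ?_
    replace hI := hI.mono e'
    replace hb := hb.mono e'
    rw [Fm.innerAll_subst] at hI
    rw [Fm.subst_subst, Fm.subst_subst]
    refine .andI ((hA _ _ _).1 (int_intro hb.left ?_)) ((hB _ _ _).1 (int_intro hb.right ?_))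
    · refine innerAll_intro fun Ξ H₃ v c' e'' hc' => ?_
      have h' := hI.mono e''
      rw [Fm.innerAll_subst] at h'
      have := innerAll_elim h' (hc'.append (hc.mono e'').right)
      rw [Fm.inner_and] at this
      simpa using Derives.andE₁ this
    · refine innerAll_intro fun Ξ H₃ v c' e'' hc' => ?_
      have h' := hI.mono e''
      rw [Fm.innerAll_subst] at h'
      have := innerAll_elim h' ((hc.mono e'').left.append hc')
      rw [Fm.inner_and] at this
      simpa using Derives.andE₂ this
  · intro h
    refine int_elim ((hA _ _ _).2 (.andE₁ h)) fun Θ H' u b e hb hI => ?_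
    have h' := ((hB _ _ _).2 (.andE₂ h)).mono e
    rw [Fm.int_subst] at h'
    refine int_elim h' fun Θ' H'' u' d e' hd hI' => ?_
    simp only [Fm.int_subst]
    refine int_intro (A := A.and B) ((hb.mono e').append hd) ?_
    refine innerAll_intro fun Ξ H₃ v c e'' hc => ?_
    have h₁ := innerAll_elim ((Fm.innerAll_subst _ _ _ _ ▸ hI.mono (e'.trans e'') :)) hc.left
    have h₂ := innerAll_elim ((Fm.innerAll_subst _ _ _ _ ▸ hI'.mono e'' :)) hc.right
    rw [Fm.inner_and, Tms.append_subst]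
    refine .andI ?_ ?_
    · simpa using h₁
    · simpa using h₂

/-- `∀̃ˢᵗ e (∀̃ c ≤* G e, A_I(b,c) → B_I(d,e))`. -/
def Fm.impBody {Δ : Ctx} (A B : Fm Γ) (s : Sub Γ Δ) (b : Tms Δ A.wit)
    (y : Tms Δ (B.wit ++ A.chal.map (arrs B.chal))) : Fm Δ :=
  allStMon B.chal (.imp
    (A.innerLe (s.comp (Sub.wkT B.chal)) (b.subst (Sub.wkT B.chal))
      (Tms.apps B.chal A.chal ((Tms.right B.wit y).subst (Sub.wkT B.chal)) (vars B.chal)))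
    (B.inner (s.comp (Sub.wkT B.chal)) ((Tms.left B.wit y).subst (Sub.wkT B.chal))
      (vars B.chal)))

theorem Fm.impBody_subst {Δ Θ : Ctx} (s : Sub Γ Δ) (b : Tms Δ A.wit)
    (y : Tms Δ (B.wit ++ A.chal.map (arrs B.chal))) (u : Sub Δ Θ) :
    (A.impBody B s b y).subst u = A.impBody B (s.comp u) (b.subst u) (y.subst u) := by
  simp [Fm.impBody, Fm.subst]

theorem impBody_elim {Δ : Ctx} {H : List (Fm Δ)} {s : Sub Γ Δ} {b : Tms Δ A.wit}
    {y : Tms Δ (B.wit ++ A.chal.map (arrs B.chal))} {e : Tms Δ B.chal}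
    (h : D H (A.impBody B s b y)) (he : StMon H e) :
    D H (.imp (A.innerLe s b (Tms.apps B.chal A.chal (Tms.right B.wit y) e))
      (B.inner s (Tms.left B.wit y) e)) := by
  simpa [Fm.subst] using allStMon_elim h he

/-- The core of the case `→`, for one fixed `b`: the tuple `y` consists of a witness `d` for the
conclusion, from independence of premises, and a functional `G` bounding the challenges to the
premise, from Markov's principle and choice. -/
theorem exists_impBody {Δ : Ctx} {H : List (Fm Δ)} {s : Sub Γ Δ} {b : Tms Δ A.wit}
    (h : D H (.imp (A.innerAll s b) (B.int s))) {C : Fm Δ}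
    (hC : ∀ (Θ : Ctx) (H' : List (Fm Θ)) (u : Sub Δ Θ)
      (y : Tms Θ (B.wit ++ A.chal.map (arrs B.chal))), Ext H H' u → StMon H' y →
      D H' (A.impBody B (s.comp u) (b.subst u) y) → D H' (C.subst u)) : D H C := by
  refine independence (A.inner_internal _ _ _) h fun Θ H' u d e hd h₁ => ?_
  -- Independence of premises gives some `d' ≤* d`; by monotonicity in the witness, `d` itself
  -- works.
  have h₂ : D H' (.imp (A.innerAll (s.comp u) (b.subst u)) (B.innerAll (s.comp u) d)) := by
    refine imp_intro fun H'' hs h' => ?_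
    have h₃ : D H'' (exLeMon B.wit d _) :=
      .impE (h₁.weaken hs) (by simpa [Fm.innerAll] using h')
    refine exLeMon_elim h₃ fun Ξ H₃ v d' e' _ hd' hI => ?_
    rw [Fm.innerAll_subst]
    refine innerAll_mono hd' ?_
    simpa using hI
  let X : Fm (ext (ext Θ B.chal) A.chal) :=
    let v : Sub Θ _ := (Sub.wkT B.chal).comp (Sub.wkT A.chal)
    .imp (A.innerLe (s.comp (u.comp v)) (b.subst (u.comp v)) (vars A.chal))
      (B.inner (s.comp (u.comp v)) (d.subst v) ((vars B.chal).subst (Sub.wkT A.chal)))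
  have hX : D H' (allStMon B.chal (exStMon A.chal X)) := by
    refine allStMon_intro fun Ξ H'' v c e' hc => ?_
    have h₃ : D H'' (.imp (A.innerAll (s.comp (u.comp v)) (b.subst (u.comp v)))
        (B.inner (s.comp (u.comp v)) (d.subst v) c)) := by
      refine imp_intro fun H₃ hs h' => ?_
      refine innerAll_elim (.impE ?_ h') (hc.weaken hs)
      simpa [Fm.subst] using (h₂.mono e').weaken hs
    -- With `d` and the challenge `c` to `B` fixed, the conclusion is internal, as Markov's
    -- principle requires.
    refine markov (A.inner_internal _ _ _) (B.inner_internal _ _ _) h₃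
      fun Ξ' H₃ w y e'' hy h₄ => ?_
    rw [exStMon_subst, exStMon_subst]
    refine exStMon_intro hy ?_
    simpa [X, Fm.subst, Fm.innerLe] using h₄
  refine choice hX fun Ξ H'' v G e' hG hC' => ?_
  rw [Fm.subst_subst]
  refine hC Ξ H'' (u.comp v) ((d.subst v).append G) (e.trans e') ((hd.mono e').append hG) ?_
  refine allStMon_intro fun Ξ₁ H₃ w c e'' hc => ?_
  refine hC' Ξ₁ H₃ w c e'' hc _ fun Ξ₂ H₄ w' y e₃ hy h₃ => ?_
  have h₄ : D H₄ (.imp (A.innerLe (s.comp (u.comp (v.comp (w.comp w'))))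
      (b.subst (u.comp (v.comp (w.comp w')))) y)
      (B.inner (s.comp (u.comp (v.comp (w.comp w')))) (d.subst (v.comp (w.comp w')))
        (c.subst w'))) := by
    simpa [X, Fm.subst] using h₃
  have h₅ : D H₄ (.imp (A.innerLe (s.comp (u.comp (v.comp (w.comp w'))))
      (b.subst (u.comp (v.comp (w.comp w'))))
      (Tms.apps B.chal A.chal (G.subst (w.comp w')) (c.subst w')))
      (B.inner (s.comp (u.comp (v.comp (w.comp w')))) (d.subst (v.comp (w.comp w')))
        (c.subst w'))) :=
    -- Choice yields only a bound `y ≤* G c`, but a premise bounded by `G c` is stronger than one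
    -- bounded by `y`.
    imp_intro fun H₅ hs h₆ => .impE (h₄.weaken hs)
      (innerLe_anti h₆ (MajT.weaken (by simpa using hy) hs))
  simpa [Fm.subst, Tms.append_subst] using h₅

theorem Characterized.imp (hA : Characterized A) (hB : Characterized B) :
    Characterized (A.imp B) := by
  intro Δ s H
  constructor
  · intro h
    refine int_elim h fun Θ H' u fg e hfg hI => ?_
    rw [Fm.subst_subst]
    refine imp_intro fun H'' e' h' => ?_
    refine int_elim ((hA _ _ _).2 h') fun Θ' H₃ u' b e'' hb hI' => ?_
    have e₃ := (Ext.of_subset e').trans e''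
    rw [Fm.subst_subst]
    refine (hB _ _ _).1 ?_
    have hfgb := (hfg.mono e₃).apps hb
    refine int_intro hfgb.left (innerAll_intro fun Ξ H₄ v c e₄ hc => ?_)
    have h₁ := innerAll_elim ((Fm.innerAll_subst _ _ _ _ ▸ hI.mono (e₃.trans e₄) :))
      ((hb.mono e₄).append hc)
    rw [Fm.inner_imp] at h₁
    have h₂ := innerAll_le (Fm.innerAll_subst _ _ _ _ ▸ hI'.mono e₄ :)
      ((hfgb.mono e₄).right.apps hc)
    have h₃ := Derives.impE h₁ (by simpa [Fm.innerLe] using h₂)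
    simpa using h₃
  · intro h
    let X : Fm (ext (ext Δ A.wit) (B.wit ++ A.chal.map (arrs B.chal))) :=
      A.impBody B (s.comp ((Sub.wkT A.wit).comp (Sub.wkT _))) ((vars A.wit).subst (Sub.wkT _))
        (vars _)
    have hX : D H (allStMon A.wit (exStMon _ X)) := by
      refine allStMon_intro fun Θ H' u b e hb => ?_
      have h₁ : D H' (.imp (A.innerAll (s.comp u) b) (B.int (s.comp u))) := by
        refine imp_intro fun H'' hs h' => ?_
        refine (hB _ _ _).2 (.impE ?_ ((hA _ _ _).1 (int_intro (hb.weaken hs) h')))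
        simpa [Fm.subst] using (h.mono e).weaken hs
      refine exists_impBody h₁ fun Θ' H'' v y e' hy h₂ => ?_
      rw [exStMon_subst, exStMon_subst]
      refine exStMon_intro hy ?_
      simpa [X, Fm.impBody_subst] using h₂
    refine choice hX fun Θ H' u fg e hfg hC => ?_
    rw [Fm.int_subst]
    refine int_intro (A := A.imp B) hfg (innerAll_intro fun Ξ H'' v be e' hbe => ?_)
    rw [Fm.inner_imp]
    refine hC Ξ H'' v _ e' hbe.left _ fun Ξ₁ H₃ w y e'' hy h₁ => ?_
    have h₂ : D H₃ (A.impBody B (s.comp (u.comp (v.comp w)))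
        (Tms.left A.wit (be.subst w)) y) := by
      simpa [X, Fm.impBody_subst] using h₁
    have hb := hbe.mono e''
    have h₃ : D H₃ (.imp (A.innerLe (s.comp (u.comp (v.comp w))) (Tms.left A.wit (be.subst w))
        (Tms.apps B.chal A.chal (Tms.right B.wit (Tms.apps A.wit _ (fg.subst (v.comp w))
          (Tms.left A.wit (be.subst w)))) (Tms.right A.wit (be.subst w))))
        (B.inner (s.comp (u.comp (v.comp w))) (Tms.left B.wit (Tms.apps A.wit _
          (fg.subst (v.comp w)) (Tms.left A.wit (be.subst w)))) (Tms.right A.wit (be.subst w)))) := by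
      -- Here too choice only bounds `y` by `fg b`. Enlarging the witness part preserves the
      -- conclusion, and enlarging the challenge part strengthens the premise.
      have hy' : MajT H₃ y (Tms.apps A.wit _ (fg.subst (v.comp w))
          (Tms.left A.wit (be.subst w))) := by simpa using hy
      refine imp_intro fun H₄ hs h₄ => ?_
      refine inner_mono B (hy'.weaken hs).left (hb.weaken hs).right.2
        (.impE ((impBody_elim h₂ hb.right).weaken hs) (innerLe_anti h₄ ?_))
      exact MajT.apps (hy'.weaken hs).right (hb.weaken hs).right.2
    simpa [Fm.subst, Fm.innerLe] using h₃

theorem Characterized.or (hA : Characterized A) (hB : Characterized B) :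
    Characterized (A.or B) := by
  intro Δ s H
  constructor
  · intro h
    refine int_elim h fun Θ H' u b e hb hI => ?_
    -- The disjunction coded by a number `n`: `n = 0` selects `A`, `n ≠ 0` selects `B`. It is
    -- internal, as idealization requires.
    let X : Fm (ext (.nat :: Θ) (A.chal ++ B.chal)) :=
      let v : Sub Θ _ := (Sub.wk1 .nat).comp (Sub.wkT (A.chal ++ B.chal))
      let n : Tm (ext (.nat :: Θ) (A.chal ++ B.chal)) .nat := (Tm.var .vz).subst (Sub.wkT _)
      .and (.imp (.eq0 n .zero) (A.innerLe (s.comp (u.comp v))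
          ((Tms.left A.wit b).subst v) (Tms.left A.chal (vars _))))
        (.imp (.imp (.eq0 n .zero) .bot) (B.innerLe (s.comp (u.comp v))
          ((Tms.right A.wit b).subst v) (Tms.right A.chal (vars _))))
    have hX : X.Internal :=
      ⟨⟨trivial, Fm.innerLe_internal _ _ _ _⟩, ⟨trivial, trivial⟩, Fm.innerLe_internal _ _ _ _⟩
    have hXs : ∀ {Ξ : Ctx} (y : Tms Ξ (A.chal ++ B.chal)) (n : Tm Ξ .nat) (v : Sub Θ Ξ),
        X.subst (Sub.conss y (Sub.cons n v)) =
        .and (.imp (.eq0 n .zero) (A.innerLe (s.comp (u.comp v))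
          ((Tms.left A.wit b).subst v) (Tms.left A.chal y)))
        (.imp (.imp (.eq0 n .zero) .bot) (B.innerLe (s.comp (u.comp v))
          ((Tms.right A.wit b).subst v) (Tms.right A.chal y))) := by
      intro Ξ y n v
      simp [X, Fm.subst]
    refine idealization hX (fun Θ' H'' v z e' hz => ?_) fun Θ' H'' v n e' hn => ?_
    · have h₁ := innerAll_elim ((Fm.innerAll_subst _ _ _ _ ▸ hI.mono e' :)) hz
      rw [Fm.inner_or] at h₁
      refine or_elim h₁ (fun H₃ e'' h₂ => ?_) (fun H₃ e'' h₂ => ?_)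
      · refine exAllLe_intro .zero fun Ξ H₄ w y e₃ hy => ?_
        rw [hXs]
        refine .andI (.impI ?_) (.impI (.botE (.impE (.hyp List.mem_cons_self)
          (.eha (.eq_refl _)))))
        have := h₂.mono e₃
        have h₃ : D H₄ (A.innerLe (s.comp (u.comp (v.comp w))) ((Tms.left A.wit b).subst (v.comp w))
            (Tms.left A.chal (z.subst w))) := by
          simpa [Fm.innerLe] using this
        exact (innerLe_anti h₃ hy.left).weaken (List.subset_cons_self _ _)
      · refine exAllLe_intro (.app .succ .zero) fun Ξ H₄ w y e₃ hy => ?_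
        rw [hXs]
        refine .andI (.impI (.botE (.impE (.eha (.succ_ne_zero _))
          (.hyp List.mem_cons_self)))) (.impI ?_)
        have := h₂.mono e₃
        have h₃ : D H₄ (B.innerLe (s.comp (u.comp (v.comp w)))
            ((Tms.right A.wit b).subst (v.comp w)) (Tms.right A.chal (z.subst w))) := by
          simpa [Fm.innerLe] using this
        exact (innerLe_anti h₃ hy.right).weaken (List.subset_cons_self _ _)
    · refine exists_stMon (A.chal ++ B.chal) fun Θ₁ H₁ v₁ c e₁ hc => ?_
      simp only [Fm.subst_subst]
      refine or_elim (zero_or_ne (n.subst v₁)) (fun H₃ e'' h₂ => .orI₁ ?_)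
        (fun H₃ e'' h₂ => .orI₂ ?_)
      · refine (hA _ _ _).1 (int_intro
          (((hb.mono (e'.trans e₁)).weaken e'').left) (innerAll_intro fun Ξ H₄ w c' e₃ hc' => ?_))
        have e₄ := (e₁.weaken e'').trans e₃
        have h₃ := hn Ξ H₄ (v₁.comp w) (c'.append (Tms.right A.chal (c.subst w))) e₄
          (hc'.append ((hc.weaken e'').mono e₃).right).1
        rw [hXs] at h₃
        have h₄ := Derives.impE (.andE₁ h₃) (by simpa [Fm.subst] using h₂.mono e₃)
        refine innerLe_elim (c := c') ?_ hc'.2 hc'.2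
        simpa using h₄
      · refine (hB _ _ _).1 (int_intro
          (((hb.mono (e'.trans e₁)).weaken e'').right) (innerAll_intro fun Ξ H₄ w c' e₃ hc' => ?_))
        have e₄ := (e₁.weaken e'').trans e₃
        have h₃ := hn Ξ H₄ (v₁.comp w) ((Tms.left A.chal (c.subst w)).append c') e₄
          (((hc.weaken e'').mono e₃).left.append hc').1
        rw [hXs] at h₃
        have h₄ := Derives.impE (.andE₂ h₃) (by simpa [Fm.subst] using h₂.mono e₃)
        refine innerLe_elim (c := c') ?_ hc'.2 hc'.2
        simpa using h₄
  · intro h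
    refine or_elim h (fun H' e h => ?_) (fun H' e h => ?_)
    · refine int_elim ((hA _ _ _).2 h) fun Θ H' u b e hb hI => ?_
      -- The disjunct that is not asserted still needs a witness, and any standard monotone tuple
      -- will do.
      refine exists_stMon B.wit fun Θ' H'' v d e' hd => ?_
      simp only [Fm.int_subst]
      refine int_intro (A := A.or B) ((hb.mono e').append hd) ?_
      refine innerAll_intro fun Ξ H₃ w c e'' hc => ?_
      rw [Fm.inner_or, Tms.append_subst]
      refine .orI₁ ?_
      have := innerAll_le ((Fm.innerAll_subst _ _ _ _ ▸ hI.mono (e'.trans e'') :)) hc.left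
      simpa [Fm.innerLe] using this
    · refine int_elim ((hB _ _ _).2 h) fun Θ H' u d e hd hI => ?_
      refine exists_stMon A.wit fun Θ' H'' v b e' hb => ?_
      simp only [Fm.int_subst]
      refine int_intro (A := A.or B) (hb.append (hd.mono e')) ?_
      refine innerAll_intro fun Ξ H₃ w c e'' hc => ?_
      rw [Fm.inner_or, Tms.append_subst]
      refine .orI₂ ?_
      have := innerAll_le ((Fm.innerAll_subst _ _ _ _ ▸ hI.mono (e'.trans e'') :)) hc.right
      simpa [Fm.innerLe] using this

theorem Characterized.all {σ : Ty} {A : Fm (σ :: Γ)} (hA : Characterized A) :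
    Characterized (.all σ A) := by
  intro Δ s H
  constructor
  · intro h
    refine int_elim h fun Θ H' u b e hb hI => ?_
    rw [Fm.subst_subst]
    refine all_intro fun Θ' H'' v t e' => ?_
    rw [Fm.subst_subst]
    refine (hA _ _ _).1 (int_intro (hb.mono e') (innerAll_intro fun Ξ H₃ w c e'' hc => ?_))
    have h₁ := innerAll_elim ((Fm.innerAll_subst _ _ _ _ ▸ hI.mono (e'.trans e'') :)) hc
    simpa using inner_all_elim h₁ (t.subst w)
  · intro h
    let X : Fm (ext (σ :: Δ) A.wit) :=
      A.innerAll ((s.lift σ).comp (Sub.wkT A.wit)) (vars A.wit)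
    have hX : D H (.all σ (exSt A.wit X)) := by
      refine all_intro fun Θ H' u t e => ?_
      have h₁ : D H' (A.subst (Sub.cons t (s.comp u))) := by
        simpa using all_elim (h.mono e) t
      refine int_elim ((hA _ _ _).2 h₁) fun Θ' H'' v b e' hb hI => ?_
      rw [Fm.subst_subst, exSt_subst]
      -- Realization asks only for a standard witness, so monotonicity of `b` is dropped; the bound
      -- it returns is monotone again.
      refine exSt_intro hb.1 ?_
      simpa [X] using hI
    refine realization hX fun Θ H' u b e hb hC => ?_
    rw [Fm.int_subst]
    refine int_intro (A := .all σ A) hb (innerAll_intro fun Ξ H'' v c e' hc => ?_)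
    refine inner_all_intro fun Ξ' H₃ w t e'' => ?_
    refine hC _ _ (v.comp w) t (e'.trans e'') _ fun Θ' H₄ w' y e₃ hy hI => ?_
    rw [Fm.inner_subst]
    refine innerAll_elim (innerAll_mono (b := y) ?_ ?_) ((hc.mono e'').mono e₃)
    · simpa using hy
    · simpa [X] using hI

theorem Characterized.ex {σ : Ty} {A : Fm (σ :: Γ)} (hA : Characterized A) :
    Characterized (.ex σ A) := by
  intro Δ s H
  constructor
  · intro h
    refine int_elim h fun Θ H' u b e hb hI => ?_
    -- The bounded form of `A_I` is used because idealization ranges over all `y ≤* z`, monotone or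
    -- not, and only the bounded form passes from `z` to such `y`.
    let X : Fm (ext (σ :: Θ) A.chal) :=
      A.innerLe (((s.comp u).lift σ).comp (Sub.wkT A.chal))
        (Tms.subst ((Sub.wk1 σ).comp (Sub.wkT A.chal)) (σs := A.wit) b) (vars A.chal)
    refine idealization (X := X) (Fm.innerLe_internal _ _ _ _) (fun Θ' H'' v z e' hz => ?_)
      fun Θ' H'' v t e' ht => ?_
    · have h₁ := innerAll_elim ((Fm.innerAll_subst _ _ _ _ ▸ hI.mono e' :)) hz
      refine inner_ex_elim h₁ fun Ξ H₃ w t e'' h₂ => ?_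
      rw [exAllLe_subst]
      refine exAllLe_intro t fun Ξ' H₄ w' y e₃ hy => ?_
      have h₃ := h₂.mono e₃
      rw [Fm.innerLe_subst] at h₃
      simpa [X] using innerLe_anti h₃ hy
    · rw [Fm.subst_subst]
      refine ex_intro t ?_
      simp only [Fm.subst_subst]
      refine (hA _ _ _).1 (int_intro (hb.mono e') (innerAll_intro fun Ξ H₃ w c e'' hc => ?_))
      -- A monotone `c` satisfies `c ≤* c`, so the bounded form at `c` gives `A_I` at `c`.
      refine innerLe_elim ?_ hc.2 hc.2
      simpa [X] using ht Ξ H₃ w c e'' hc.1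
  · intro h
    refine ex_elim h fun Θ H' u t e h₁ => ?_
    rw [Fm.subst_subst] at h₁
    refine int_elim ((hA _ _ _).2 h₁) fun Θ' H'' v b e' hb hI => ?_
    simp only [Fm.int_subst]
    refine int_intro (A := .ex σ A) hb (innerAll_intro fun Ξ H₃ w c e'' hc => ?_)
    refine inner_ex_intro (t.subst (v.comp w)) ?_
    have := innerAll_le ((Fm.innerAll_subst _ _ _ _ ▸ hI.mono e'' :)) hc
    simpa using this

end

-- Assembly of the induction and the main theorem.

theorem characterized {Γ : Ctx} (A : Fm Γ) : Characterized A := by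
  induction A with
  | eq0 t u =>
    exact .of_int_eq fun _ s => congrArg (fun s => Fm.subst s (.eq0 t u))
      ((Sub.comp_id (s.comp (Sub.id _))).trans (Sub.comp_id s))
  | st t => exact .st t
  | bot => exact .of_int_eq fun _ _ => rfl
  | and A B hA hB => exact .and hA hB
  | or A B hA hB => exact .or hA hB
  | imp A B hA hB => exact .imp hA hB
  | all σ A hA => exact .all hA
  | ex σ A hA => exact .ex hA

end NonstandardHA

theorem mainTheorem2 {Γ : NonstandardHA.Ctx} (Φ : NonstandardHA.Fm Γ) :
    NonstandardHA.Provable (fun _ A => NonstandardHA.CharAx A)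
      (NonstandardHA.Fm.iff Φ.interp Φ) := by
  rw [NonstandardHA.Fm.interp_eq]
  have h := NonstandardHA.characterized Φ Γ (NonstandardHA.Sub.id Γ)
  simp only [NonstandardHA.Fm.subst_id] at h
  -- Equiderivability under the assumption list consisting of the formula alone becomes, by
  -- discharging it, a derivable implication in each direction.
  exact .andI (.impI ((h _).1 (.hyp List.mem_cons_self)))
    (.impI ((h _).2 (.hyp List.mem_cons_self)))
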